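/- **Conventions.** Operators on $N$ qubits are $2^N\times 2^N$ unitary matrices indexed by $\{0,1\}^N$. The Toffoli gates are $|x_1,\dots,x_m,b\rangle\mapsto|x_1,\dots,x_m,b\oplus(x_1\wedge\dots\wedge x_m)\rangle$ ($m\ge 0$); the fan-out gates $F$ are $|y_1,\dots,y_m,b\rangle\mapsto|y_1\oplus b,\dots,y_m\oplus b,b\rangle$; for $q\ge 1$ the $\mathrm{MOD}_q$ gates are $|x_1,\dots,x_m,b\rangle\mapsto|x_1,\dots,x_m,b\oplus \mathrm{Mod}_q(x)\rangle$, where $\mathrm{Mod}_q(x)=1$ iff $x_1+\dots+x_m\equiv 0 \pmod q$. Let $\mathcal E$ be a collection of gates. A *layer* (with additional gates $\mathcal E$) is either a Kronecker product of one-qubit gates (elements of $U(2)$), Toffoli gates and gates from $\mathcal E$, each acting on consecutive lines, or a controlled-not layer, i.e. simultaneous controlled-nots on an arbitrary collection of disjoint pairs of lines. A sequence of operators is of *constant depth with additional gates $\mathcal E$* if there are a constant $d$ and a finite set $S\subset U(2)$ such that every operator of the sequence is a product of at most $d$ layers whose one-qubit gates all lie in $S$. An *operator family* is a sequence $\{F_n\}_{n\ge0}$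 with $F_n\in U(2^{n+p(n)})$ for a polynomial $p$ with natural-number coefficients. $\mathrm{QACC}[q]$ (for $q\ge1$) and $\mathrm{QAC}^{(0)}_{wf}$ are the classes of operator families of constant depth with, respectively, all $\mathrm{MOD}_q$ gates and all fan-out gates as additional gates; $\mathrm{QACC}=\bigcup_{q\ge1}\mathrm{QACC}[q]$. A family $\{F_n\}$, $F_n\in U(2^{s(n)})$, is *$\mathrm{QAC}^{(0)}$ reducible* to a family $\{G_n\}$ if there are a polynomial $r$ (with natural-number coefficients) and operators $R_n$ on $s(n)+r(n)$ qubits, of constant depth with all the operators $G_m$ as additional gates, such that for every $n$ there is $z\in\{0,1\}^{r(n)}$ with $\langle y|F_n|x\rangle=\langle y,z|R_n|x,z\rangle$ for all $x,y\in\{0,1\}^{s(n)}$. Two families are *$\mathrm{QAC}^{(0)}$ equivalent* if each is reducible to the other. For classes $\mathcal C,\mathcal D$ of operator families, $\mathcal C=\mathcal D$ *up to $\mathrm{QAC}^{(0)}$ reductions* means that every family in $\mathcal C$ is $\mathrm{QAC}^{(0)}$ reducible to some family in $\mathcal D$, and every family in $\mathcal D$ to some family in $\mathcal C$. **Theorem.**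 Let $q\ge 2$. Up to $\mathrm{QAC}^{(0)}$ reductions, $$\mathrm{QACC}=\mathrm{QACC}[q],\qquad \mathrm{QAC}^{(0)}_{wf}=\mathrm{QACC}[q],\qquad \mathrm{QAC}^{(0)}_{wf}=\mathrm{QACC}.$$ Moreover the operator family $\{\mathrm{MOD}_q\}$ (whose $n$-th member has $n$ inputs and one target) is $\mathrm{QAC}^{(0)}$ equivalent to the family $\{F\}$ of fan-out gates (whose $n$-th member is $n$-ary), and to the family $\{\mathrm{MOD}_t\}$ for every $t\ge 2$. -/

import Mathlib

/-- Computational basis labels of a register of `N` lines: bit strings of length `N`. -/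
abbrev Bits (N : ℕ) : Type := Fin N → Bool

/-- Operators on `N` qubits, as `2^N × 2^N` matrices: `M y x` is the amplitude `⟨y| M |x⟩`. -/
abbrev Op (N : ℕ) : Type := Matrix (Bits N) (Bits N) ℂ

/-- The operator `|x⟩ ↦ |f x⟩`. -/
def basisOp {N : ℕ} (f : Bits N → Bits N) : Op N :=
  Matrix.of fun y x => if y = f x then 1 else 0

theorem basisOp_mem_unitaryGroup {N : ℕ} {f : Bits N → Bits N}
    (hf : Function.Involutive f) : basisOp f ∈ Matrix.unitaryGroup (Bits N) ℂ := by
  have hs : star (basisOp f) = basisOp f := by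
    ext y x
    have h : (x = f y) ↔ (y = f x) :=
      ⟨fun h => by rw [h, hf], fun h => by rw [h, hf]⟩
    simp [basisOp, Matrix.star_apply, h]
  rw [Matrix.mem_unitaryGroup_iff, hs]
  ext y x
  simp [basisOp, Matrix.mul_apply, Matrix.one_apply, hf x]

/-- Flip the last line of `m + 1` lines iff `c` holds of the first `m` lines. -/
def flipLast {m : ℕ} (c : Bits m → Bool) (x : Bits (m + 1)) : Bits (m + 1) :=
  Fin.snoc (α := fun _ => Bool) (Fin.init x) (xor (x (Fin.last m)) (c (Fin.init x)))

theorem flipLast_involutive {m : ℕ} (c : Bits m → Bool) :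
    Function.Involutive (flipLast c) := by
  intro x
  simp [flipLast]

/-- The Toffoli gate `∧_m(X)` on `m + 1` lines: `|x, b⟩ ↦ |x, b ⊕ (x₁ ∧ ⋯ ∧ x_m)⟩`. -/
def toffoliGate (m : ℕ) : Op (m + 1) :=
  basisOp (flipLast fun x => decide (∀ i, x i = true))

/-- The gate `MOD_q` on `m + 1` lines:
`|x, b⟩ ↦ |x, b ⊕ Mod_q(x)⟩`, where `Mod_q(x) = 1` iff `x₁ + ⋯ + x_m ≡ 0 (mod q)`. -/
def modGate (q m : ℕ) : Op (m + 1) :=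
  basisOp (flipLast fun x => decide ((∑ i, (x i).toNat) ≡ 0 [MOD q]))

/-- The action of fan-out on basis labels: `(y₁, …, y_m, b) ↦ (y₁ ⊕ b, …, y_m ⊕ b, b)`. -/
def fanoutMap {m : ℕ} (x : Bits (m + 1)) : Bits (m + 1) :=
  Fin.snoc (α := fun _ => Bool) (fun i => xor (x i.castSucc) (x (Fin.last m))) (x (Fin.last m))

theorem fanoutMap_involutive {m : ℕ} :
    Function.Involutive (fanoutMap : Bits (m + 1) → Bits (m + 1)) := by
  intro x
  funext i
  refine Fin.lastCases ?_ (fun j => ?_) i <;> simp [fanoutMap]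

/-- The `m`-ary fan-out gate. -/
def fanoutGate (m : ℕ) : Op (m + 1) := basisOp fanoutMap

/-- A collection of gates, on any number of lines. -/
abbrev GateSet : Type := ∀ k : ℕ, Op k → Prop

/-- The Kronecker product `A ⊗ B`; `A` acts on the first `k` lines, `B` on the last `N`. -/
def kron {k N : ℕ} (A : Op k) (B : Op N) : Op (k + N) :=
  Matrix.of fun y x =>
    A (fun i => y (Fin.castAdd N i)) (fun i => x (Fin.castAdd N i)) *
      B (fun i => y (Fin.natAdd k i)) (fun i => x (Fin.natAdd k i))

/-- `IsKron 𝒢 N M`: the operator `M` on `N` lines is a Kronecker product of gates from `𝒢`,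
each acting on consecutive lines. -/
inductive IsKron (𝒢 : GateSet) : ∀ N : ℕ, Op N → Prop
  | nil : IsKron 𝒢 0 1
  | cons {k N : ℕ} {A : Op k} {B : Op N} : 𝒢 k A → IsKron 𝒢 N B → IsKron 𝒢 (k + N) (kron A B)

/-- The idle line and the controlled-not gate `∧₁(X)`. -/
inductive CNotGates : GateSet
  | idle : CNotGates 1 1
  | cnot : CNotGates 2 (toffoliGate 1)

/-- A controlled-not layer: simultaneous controlled-nots on an arbitrary collection of disjoint
(ordered) pairs of lines, that is, a Kronecker product of controlled-nots and idle lines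
conjugated by a permutation of the lines. -/
def IsCNotLayer (N : ℕ) (M : Op N) : Prop :=
  ∃ (π : Equiv.Perm (Fin N)) (D : Op N), IsKron CNotGates N D ∧
    M = D.submatrix (fun x => x ∘ π) (fun x => x ∘ π)

/-- The gates of a Kronecker layer: one-qubit gates from `S`, all Toffoli gates, and the
additional gates `ℰ`. -/
inductive LayerGates (S : Set (Op 1)) (ℰ : GateSet) : GateSet
  | oneQubit {U : Op 1} : U ∈ S → LayerGates S ℰ 1 U
  | toffoli (m : ℕ) : LayerGates S ℰ (m + 1) (toffoliGate m)
  | extra {k : ℕ} {A : Op k} : ℰ k A → LayerGates S ℰ k A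

/-- A layer: a Kronecker product of gates, or a controlled-not layer. -/
def IsLayer (S : Set (Op 1)) (ℰ : GateSet) (N : ℕ) (M : Op N) : Prop :=
  IsKron (LayerGates S ℰ) N M ∨ IsCNotLayer N M

/-- `M` is a product of at most `d` layers. -/
def IsCircuit (S : Set (Op 1)) (ℰ : GateSet) (d N : ℕ) (M : Op N) : Prop :=
  ∃ L : List (Op N), L.length ≤ d ∧ (∀ A ∈ L, IsLayer S ℰ N A) ∧ M = L.prod

/-- A sequence of operators (of any widths `w n`) given by circuits of constant depth with
additional gates `ℰ`, using a fixed finite set of one-qubit gates. -/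
def ConstDepth (ℰ : GateSet) (w : ℕ → ℕ) (R : ∀ n, Op (w n)) : Prop :=
  ∃ (S : Set (Op 1)) (d : ℕ), S.Finite ∧ S ⊆ Matrix.unitaryGroup (Bits 1) ℂ ∧
    ∀ n, IsCircuit S ℰ d (w n) (R n)

/-- An operator family `{F_n}` with `F_n ∈ U(2^{n + p(n)})`, `p` a polynomial. -/
structure OpFamily where
  width : ℕ → ℕ
  width_poly : ∃ p : Polynomial ℕ, ∀ n, width n = n + p.eval n
  op : ∀ n, Matrix.unitaryGroup (Bits (width n)) ℂ

/-- The operators of a family, as additional gates. -/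
inductive FamilyGates (G : OpFamily) : GateSet
  | mk (n : ℕ) : FamilyGates G (G.width n) (G.op n)

/-- All `MOD_q` gates. -/
inductive ModGates (q : ℕ) : GateSet
  | mk (m : ℕ) : ModGates q (m + 1) (modGate q m)

/-- All fan-out gates. -/
inductive FanoutGates : GateSet
  | mk (m : ℕ) : FanoutGates (m + 1) (fanoutGate m)

/-- The class `QAC^(0)_wf` (constant depth, with fan-out gates). -/
def QAC0wf : Set OpFamily := {F | ConstDepth FanoutGates F.width fun n => F.op n}

/-- The class `QACC[q]` (constant depth, with `MOD_q` gates). -/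
def QACCmod (q : ℕ) : Set OpFamily := {F | ConstDepth (ModGates q) F.width fun n => F.op n}

/-- The class `QACC`, the union of the classes `QACC[q]` over the positive integers `q`. -/
def QACC : Set OpFamily := {F | ∃ q : ℕ, 0 < q ∧ F ∈ QACCmod q}

/-- `{F_n}` is `QAC^(0)` reducible to `{G_n}`: constant-depth circuits augmented with operators
from `{G_n}` compute `{F_n}` with polynomially many auxiliary bits, whose initial values `z` depend
on `n` only and are restored: `⟨y|F_n|x⟩ = ⟨y, z|R_n|x, z⟩` for all `x, y`. -/
def QAC0Reducible (F G : OpFamily) : Prop :=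
  ∃ (r : Polynomial ℕ) (R : ∀ n, Op (F.width n + r.eval n)),
    ConstDepth (FamilyGates G) (fun n => F.width n + r.eval n) R ∧
    ∀ n, ∃ z : Bits (r.eval n), ∀ x y : Bits (F.width n),
      (F.op n : Op (F.width n)) y x = R n (Fin.append y z) (Fin.append x z)

/-- `QAC^(0)` equivalence of operator families: mutual reducibility. -/
def QAC0Equiv (F G : OpFamily) : Prop := QAC0Reducible F G ∧ QAC0Reducible G F

/-- Equality of classes of operator families up to `QAC^(0)` reductions: every family in either
class is reducible to a family in the other. -/
def ClassEq (C D : Set OpFamily) : Prop :=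
  (∀ F ∈ C, ∃ G ∈ D, QAC0Reducible F G) ∧ (∀ G ∈ D, ∃ F ∈ C, QAC0Reducible G F)

/-- The operator family `{MOD_q}`; its `n`-th member has `n` inputs and one target. -/
def modFamily (q : ℕ) : OpFamily where
  width n := n + 1
  width_poly := ⟨1, fun n => by simp⟩
  op n := ⟨modGate q n, basisOp_mem_unitaryGroup (flipLast_involutive _)⟩

/-- The operator family `{F}` of fan-out gates; its `n`-th member is `n`-ary. -/
def fanoutFamily : OpFamily where
  width n := n + 1
  width_poly := ⟨1, fun n => by simp⟩
  op n := ⟨fanoutGate n, basisOp_mem_unitaryGroup fanoutMap_involutive⟩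

/-! The link between counting and fan-out is the diagonal gate `phaseGate`, which multiplies `|x,
b⟩` by `δ ^ (b (x₁ + ⋯ + x_m))` with `δ ^ q = 1`. It can be read in two ways. With `b` as control,
it applies the phase gate of `δ` to all the `xⱼ` simultaneously. With the `xⱼ` as controls, it
applies to the single line `b` a phase that depends only on their sum modulo `q`.

Both fan-out and `MOD_q` yield these gates. Fan-out copies `b`, so that each product `b xⱼ` can
receive its own phase (`fanout_simulates_phase`). `MOD_q` determines the residue of the sum by
testing it after each constant `k < q` is added (`mod_simulates_phase`).

Conversely, if `Re δ ≤ 0`, there are one-qubit unitaries `A`, `B` such that `A P(δ) B P(δ)* B* A* =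
i X`, where `P(δ)` is the phase gate, while the same word without the phases is `1`
(`exists_commutator_eq_qubitNot`). With `b` as control this flips all targets at once, up to a power
of `i` that is corrected on `b`: this is fan-out (`phase_simulates_fanout`). With the inputs as
controls, each nonzero residue `k` gets a word that sets an auxiliary line to `1` whenever the sum
is `k`. All auxiliary lines are `0` exactly when the sum is `0`; a NOR of them followed by
uncomputation is `MOD_t` (`phase_simulates_mod`). Fan-out and all `MOD_t` with `t ≥ 2` therefore
simulate one another.

To compose such constructions, each line is given a constant number of private auxiliary lines, so
that simulations of parallel gates do not interfere and simulation is transitive (`Impl.parTens`,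
`Simulates.trans`). Gates may first act on arbitrary disjoint sets of lines. The required wirings
are recovered because every permutation is a product of two involutions, and an involution takes
three controlled-not layers (`isCircuit_permOp`). -/

/-! ### Operators and tensor products on labelled lines -/

/-- Operators on lines labelled by an arbitrary type. -/
abbrev LOp (ι : Type) : Type := Matrix (ι → Bool) (ι → Bool) ℂ

/-- The operator `|x⟩ ↦ c x • |f x⟩`. -/
def monoOp {X Y : Type} [DecidableEq Y] (f : X → Y) (c : X → ℂ) : Matrix Y X ℂ :=
  Matrix.of fun y x => if y = f x then c x else 0

theorem monoOp_apply {X Y : Type} [DecidableEq Y] (f : X → Y) (c : X → ℂ) (y : Y) (x : X) :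
    monoOp f c y x = if y = f x then c x else 0 := rfl

theorem monoOp_mul {X Y Z : Type} [DecidableEq Y] [DecidableEq Z] [Fintype Y] (f : Y → Z)
    (c : Y → ℂ) (g : X → Y) (d : X → ℂ) :
    monoOp f c * monoOp g d = monoOp (f ∘ g) fun x => c (g x) * d x := by
  ext z x
  simp [Matrix.mul_apply, monoOp_apply]

theorem basisOp_eq_monoOp {N : ℕ} (f : Bits N → Bits N) : basisOp f = monoOp f 1 := rfl

/-- Tensor product of a family of matrices. -/
def tens {J : Type} [Fintype J] {X Y : J → Type} (A : ∀ j, Matrix (X j) (Y j) ℂ) :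
    Matrix (∀ j, X j) (∀ j, Y j) ℂ :=
  Matrix.of fun y x => ∏ j, A j (y j) (x j)

theorem tens_apply {J : Type} [Fintype J] {X Y : J → Type} (A : ∀ j, Matrix (X j) (Y j) ℂ)
    (y : ∀ j, X j) (x : ∀ j, Y j) : tens A y x = ∏ j, A j (y j) (x j) := rfl

theorem tens_mul {J : Type} [Fintype J] [DecidableEq J] {X Y Z : J → Type} [∀ j, Fintype (Y j)]
    (A : ∀ j, Matrix (X j) (Y j) ℂ) (B : ∀ j, Matrix (Y j) (Z j) ℂ) :
    tens A * tens B = tens fun j => A j * B j := by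
  ext y x
  simp only [Matrix.mul_apply, tens_apply, ← Finset.prod_mul_distrib]
  rw [Finset.prod_univ_sum, Fintype.piFinset_univ]

theorem tens_monoOp {J : Type} [Fintype J] {X Y : J → Type} [∀ j, DecidableEq (X j)]
    (f : ∀ j, Y j → X j) (c : ∀ j, Y j → ℂ) :
    tens (fun j => monoOp (f j) (c j)) = monoOp (fun x j => f j (x j)) fun x => ∏ j, c j (x j) := by
  ext y x
  simp only [tens_apply, monoOp_apply, funext_iff]
  split_ifs with h
  · simp [h]
  · push Not at h
    obtain ⟨j, hj⟩ := h
    exact Finset.prod_eq_zero (Finset.mem_univ j) (if_neg hj)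

/-- Split the lines into the bundles of a partition. -/
def bundle {J : Type} {κ : J → Type} {ι : Type} (e : (Σ j, κ j) ≃ ι) :
    (ι → Bool) ≃ (∀ j, κ j → Bool) where
  toFun y j i := y (e ⟨j, i⟩)
  invFun w i := w (e.symm i).1 (e.symm i).2
  left_inv y := by ext i; simp
  right_inv w := by
    ext j i
    have h := e.symm_apply_apply ⟨j, i⟩
    dsimp only
    rw [h]

/-- The tensor product of operators on the bundles of a partition of the lines. -/
def parTens {J : Type} [Fintype J] {κ : J → Type} {ι : Type} (e : (Σ j, κ j) ≃ ι)
    (A : ∀ j, LOp (κ j)) : LOp ι :=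
  (tens A).submatrix (bundle e) (bundle e)

theorem parTens_apply {J : Type} [Fintype J] {κ : J → Type} {ι : Type} (e : (Σ j, κ j) ≃ ι)
    (A : ∀ j, LOp (κ j)) (y x : ι → Bool) :
    parTens e A y x = ∏ j, A j (fun i => y (e ⟨j, i⟩)) (fun i => x (e ⟨j, i⟩)) := rfl

theorem parTens_mul {J : Type} [Fintype J] {κ : J → Type} [∀ j, Fintype (κ j)]
    [∀ j, DecidableEq (κ j)] {ι : Type} [Fintype ι] [DecidableEq ι] (e : (Σ j, κ j) ≃ ι)
    (A B : ∀ j, LOp (κ j)) : parTens e A * parTens e B = parTens e fun j => A j * B j := by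
  classical
  rw [parTens, parTens, Matrix.submatrix_mul_equiv, tens_mul, parTens]

theorem parTens_monoOp {J : Type} [Fintype J] {κ : J → Type} [∀ j, Fintype (κ j)]
    {ι : Type} [Fintype ι] (e : (Σ j, κ j) ≃ ι)
    (f : ∀ j, (κ j → Bool) → κ j → Bool) (c : ∀ j, (κ j → Bool) → ℂ) :
    parTens e (fun j => monoOp (f j) (c j)) =
      monoOp (fun x => (bundle e).symm fun j => f j (bundle e x j))
        fun x => ∏ j, c j (bundle e x j) := by
  classical
  rw [parTens, tens_monoOp]
  ext y x
  simp [monoOp_apply, Equiv.eq_symm_apply]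

theorem one_eq_monoOp {X : Type} [DecidableEq X] : (1 : Matrix X X ℂ) = monoOp id 1 := by
  ext y x
  simp [monoOp_apply, Matrix.one_apply]

theorem parTens_one {J : Type} [Fintype J] {κ : J → Type} [∀ j, Fintype (κ j)]
    {ι : Type} [Fintype ι] (e : (Σ j, κ j) ≃ ι) :
    parTens e (fun j => (1 : LOp (κ j))) = 1 := by
  simp only [one_eq_monoOp, parTens_monoOp]
  congr 1
  · ext x : 1
    simp
  · ext x
    simp

/-- Relabel the lines. -/
def relabel {ι ι' : Type} (σ : ι ≃ ι') (M : LOp ι) : LOp ι' :=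
  M.submatrix (fun x => x ∘ σ) (fun x => x ∘ σ)

theorem relabel_mul {ι ι' : Type} [Fintype ι] [DecidableEq ι] [Fintype ι'] [DecidableEq ι']
    (σ : ι ≃ ι') (M N : LOp ι) : relabel σ (M * N) = relabel σ M * relabel σ N := by
  have h : (fun x : ι' → Bool => x ∘ σ) = σ.symm.arrowCongr (Equiv.refl Bool) := by
    ext x i
    simp [Equiv.arrowCongr]
  rw [relabel, relabel, relabel, h, Matrix.submatrix_mul_equiv]

theorem relabel_one {ι ι' : Type} [Fintype ι] [Fintype ι'] (σ : ι ≃ ι') :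
    relabel σ (1 : LOp ι) = 1 := by
  ext y x
  have : y ∘ σ = x ∘ σ ↔ y = x := σ.surjective.injective_comp_right.eq_iff
  simp [relabel, Matrix.one_apply, this]

/-! ### Parallel layers with arbitrary wiring -/

/-- A parallel layer: gates from `𝒢` acting on the bundles of an arbitrary partition of the
lines. -/
def Par (𝒢 : GateSet) {ι : Type} (M : LOp ι) : Prop :=
  ∃ (J : Type) (_ : Fintype J) (k : J → ℕ) (A : ∀ j, Op (k j)) (e : (Σ j, Fin (k j)) ≃ ι),
    (∀ j, 𝒢 (k j) (A j)) ∧ M = parTens e A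

theorem Par.mono {𝒢 ℋ : GateSet} (h : ∀ k A, 𝒢 k A → ℋ k A) {ι : Type} {M : LOp ι}
    (hM : Par 𝒢 M) : Par ℋ M := by
  obtain ⟨J, _, k, A, e, hA, rfl⟩ := hM
  exact ⟨J, _, k, A, e, fun j => h _ _ (hA j), rfl⟩

theorem Par.gate {𝒢 : GateSet} {k : ℕ} {A : Op k} (h : 𝒢 k A) : Par 𝒢 A := by
  refine ⟨Unit, inferInstance, fun _ => k, fun _ => A, Equiv.uniqueSigma _, fun _ => h, ?_⟩
  ext y x
  rw [parTens_apply, Fintype.prod_unique]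
  rfl

theorem Par.relabel {𝒢 : GateSet} {ι ι' : Type} (σ : ι ≃ ι') {M : LOp ι} (h : Par 𝒢 M) :
    Par 𝒢 (relabel σ M) := by
  obtain ⟨J, _, k, A, e, hA, rfl⟩ := h
  exact ⟨J, _, k, A, e.trans σ, hA, rfl⟩

theorem Par.parTens {𝒢 : GateSet} {J : Type} [Fintype J] {κ : J → Type} {ι : Type}
    (e : (Σ j, κ j) ≃ ι) {A : ∀ j, LOp (κ j)} (h : ∀ j, Par 𝒢 (A j)) : Par 𝒢 (parTens e A) := by
  choose L _ k B f hB hA using h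
  refine ⟨Σ j, L j, inferInstance, fun p => k p.1 p.2, fun p => B p.1 p.2,
    ((Equiv.sigmaAssoc fun j l => Fin (k j l)).trans (Equiv.sigmaCongrRight f)).trans e,
    fun p => hB _ _, ?_⟩
  ext y x
  rw [parTens_apply, parTens_apply, Fintype.prod_sigma]
  refine Finset.prod_congr rfl fun j _ => ?_
  rw [hA j]
  rfl

theorem Par.one {𝒢 : GateSet} (h : 𝒢 1 1) {ι : Type} [Fintype ι] : Par 𝒢 (1 : LOp ι) := by
  have := Par.parTens (Equiv.sigmaUnique ι fun _ => Fin 1) fun _ : ι => Par.gate h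
  rwa [parTens_one] at this

/-- Let `M` act on the lines in the range of `f`. -/
noncomputable def extOp {κ ι : Type} (f : κ → ι) (M : LOp κ) : LOp ι :=
  open Classical in
  Matrix.of fun y x => if ∀ i, i ∉ Set.range f → y i = x i then M (y ∘ f) (x ∘ f) else 0

/-- The lines outside the range of `f` form a second bundle, filled with copies of the idle gate
`1`. -/
theorem Par.extOp {𝒢 : GateSet} (h1 : 𝒢 1 1) {κ ι : Type} [Fintype ι] {f : κ → ι}
    (hf : Function.Injective f) {M : LOp κ} (h : Par 𝒢 M) : Par 𝒢 (extOp f M) := by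
  classical
  let C : Bool → Type := fun b => match b with
    | true => κ
    | false => {i // i ∉ Set.range f}
  let A : ∀ b, LOp (C b) := fun b => match b with
    | true => M
    | false => (1 : LOp {i // i ∉ Set.range f})
  let g : (Σ b, C b) → ι := fun p => match p with
    | ⟨true, i⟩ => f i
    | ⟨false, i⟩ => i.1
  have hg : Function.Bijective g := by
    constructor
    · rintro ⟨_ | _, i⟩ ⟨_ | _, j⟩ hij
      · have : i = j := Subtype.ext hij
        rw [this]
      · exact absurd ⟨j, hij.symm⟩ i.2
      · exact absurd ⟨i, hij⟩ j.2
      · rw [hf hij]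
    · intro i
      by_cases hi : i ∈ Set.range f
      · obtain ⟨j, rfl⟩ := hi
        exact ⟨⟨true, j⟩, rfl⟩
      · exact ⟨⟨false, ⟨i, hi⟩⟩, rfl⟩
  have hA : ∀ b, Par 𝒢 (A b) := by
    rintro (_ | _)
    · exact Par.one h1
    · exact h
  convert Par.parTens (Equiv.ofBijective g hg) hA using 1
  ext y x
  rw [parTens_apply, Fintype.prod_bool]
  have h2 : (A false (fun i => y (Equiv.ofBijective g hg ⟨false, i⟩))
      fun i => x (Equiv.ofBijective g hg ⟨false, i⟩)) =
      if ∀ i, i ∉ Set.range f → y i = x i then 1 else 0 := by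
    change (1 : LOp {i // i ∉ Set.range f}) (fun i => y i.1) (fun i => x i.1) = _
    simp [Matrix.one_apply, funext_iff]
  rw [h2, mul_ite, mul_one, mul_zero, _root_.extOp, Matrix.of_apply]
  split_ifs <;> rfl

theorem extOp_monoOp {κ ι : Type} [Fintype κ] [Fintype ι] (f : κ → ι) (g : (κ → Bool) → κ → Bool)
    (c : (κ → Bool) → ℂ) (F : (ι → Bool) → ι → Bool)
    (h1 : ∀ x k, F x (f k) = g (x ∘ f) k) (h2 : ∀ x i, i ∉ Set.range f → F x i = x i) :
    extOp f (monoOp g c) = monoOp F fun x => c (x ∘ f) := by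
  ext y x
  have key : ((∀ i, i ∉ Set.range f → y i = x i) ∧ y ∘ f = g (x ∘ f)) ↔ y = F x := by
    constructor
    · rintro ⟨h, h'⟩
      ext i
      by_cases hi : i ∈ Set.range f
      · obtain ⟨k, rfl⟩ := hi
        rw [h1, ← h']
        rfl
      · rw [h i hi, h2 x i hi]
    · rintro rfl
      exact ⟨fun i hi => h2 x i hi, funext fun k => h1 x k⟩
  simp only [extOp, Matrix.of_apply, monoOp_apply]
  by_cases hy : y = F x
  · rw [if_pos (key.2 hy).1, if_pos (key.2 hy).2, if_pos hy]
  · rw [if_neg hy]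
    split_ifs with ha hb
    · exact absurd (key.1 ⟨ha, hb⟩) hy
    · rfl
    · rfl

/-- Parallel gates of the form `|x⟩ ↦ c x • |g x⟩`, acting on disjoint sets of lines. -/
theorem Par.of_monoOp {𝒢 : GateSet} (h1 : 𝒢 1 1) {J ι : Type} [Fintype J] [Fintype ι] {k : J → ℕ}
    (g : ∀ j, Bits (k j) → Bits (k j)) (c : ∀ j, Bits (k j) → ℂ)
    (hg : ∀ j, 𝒢 (k j) (monoOp (g j) (c j))) (f : ∀ j, Fin (k j) → ι)
    (hf : ∀ j i j' i', f j i = f j' i' → (⟨j, i⟩ : Σ j, Fin (k j)) = ⟨j', i'⟩)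
    (F : (ι → Bool) → ι → Bool) (hF : ∀ x j i, F x (f j i) = g j (x ∘ f j) i)
    (hF' : ∀ x i, (∀ j l, f j l ≠ i) → F x i = x i) :
    Par 𝒢 (monoOp F fun x => ∏ j, c j (x ∘ f j)) := by
  have h := Par.extOp h1 (f := fun p : Σ j, Fin (k j) => f p.1 p.2)
    (fun p p' h => hf _ _ _ _ h)
    (Par.parTens (Equiv.refl _) fun j => Par.gate (hg j))
  rw [parTens_monoOp, extOp_monoOp (F := F)] at h
  · exact h
  · rintro x ⟨j, i⟩
    exact hF x j i
  · intro x i hi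
    exact hF' x i fun j l h => hi ⟨⟨j, l⟩, h⟩

/-- A single gate of the form `|x⟩ ↦ c x • |g x⟩`. -/
theorem Par.of_monoOp_single {𝒢 : GateSet} (h1 : 𝒢 1 1) {ι : Type} [Fintype ι] {k : ℕ}
    {g : Bits k → Bits k} {c : Bits k → ℂ} (hg : 𝒢 k (monoOp g c)) {f : Fin k → ι}
    (hf : Function.Injective f) {F : (ι → Bool) → ι → Bool}
    (hF : ∀ x i, F x (f i) = g (x ∘ f) i) (hF' : ∀ x i, (∀ l, f l ≠ i) → F x i = x i) :
    Par 𝒢 (monoOp F fun x => c (x ∘ f)) := by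
  have h := Par.of_monoOp h1 (fun _ : Unit => g) (fun _ => c) (fun _ => hg) (fun _ => f)
    (fun j i j' i' h => by rw [hf h]) F (fun x _ i => hF x i) (fun x i hi => hF' x i (hi ()))
  simpa using h

/-! ### Circuits as products of parallel layers -/

/-- A product of `d` parallel layers. -/
def Circ (𝒢 : GateSet) {ι : Type} [Fintype ι] [DecidableEq ι] : ℕ → LOp ι → Prop
  | 0, M => M = 1
  | d + 1, M => ∃ A B, Par 𝒢 A ∧ Circ 𝒢 d B ∧ M = A * B

section Circ

variable {𝒢 : GateSet} {ι : Type} [Fintype ι] [DecidableEq ι]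

theorem Circ.of_par {M : LOp ι} (h : Par 𝒢 M) : Circ 𝒢 1 M :=
  ⟨M, 1, h, rfl, (mul_one M).symm⟩

theorem Circ.mul {a b : ℕ} {M N : LOp ι} (hM : Circ 𝒢 a M) (hN : Circ 𝒢 b N) :
    Circ 𝒢 (a + b) (M * N) := by
  induction a generalizing M with
  | zero =>
    rw [Circ] at hM
    rwa [hM, one_mul, zero_add]
  | succ a ih =>
    obtain ⟨A, B, hA, hB, rfl⟩ := hM
    rw [Nat.succ_add_eq_add_succ]
    exact ⟨A, B * N, hA, ih hB, mul_assoc _ _ _⟩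

theorem Circ.one (h1 : 𝒢 1 1) (d : ℕ) : Circ 𝒢 d (1 : LOp ι) := by
  induction d with
  | zero => rfl
  | succ d ih => exact ⟨1, 1, Par.one h1, ih, (mul_one 1).symm⟩

theorem Circ.le (h1 : 𝒢 1 1) {a b : ℕ} (hab : a ≤ b) {M : LOp ι} (hM : Circ 𝒢 a M) :
    Circ 𝒢 b M := by
  have := hM.mul (Circ.one h1 (b - a))
  rwa [mul_one, Nat.add_sub_cancel' hab] at this

theorem Circ.mono {ℋ : GateSet} (h : ∀ k A, 𝒢 k A → ℋ k A) {d : ℕ} {M : LOp ι}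
    (hM : Circ 𝒢 d M) : Circ ℋ d M := by
  induction d generalizing M with
  | zero => exact hM
  | succ d ih =>
    obtain ⟨A, B, hA, hB, rfl⟩ := hM
    exact ⟨A, B, hA.mono h, ih hB, rfl⟩

theorem Circ.relabel {ι' : Type} [Fintype ι'] [DecidableEq ι'] (σ : ι ≃ ι') {d : ℕ} {M : LOp ι}
    (hM : Circ 𝒢 d M) : Circ 𝒢 d (relabel σ M) := by
  induction d generalizing M with
  | zero =>
    rw [Circ] at hM
    rw [hM, relabel_one]
    rfl
  | succ d ih =>
    obtain ⟨A, B, hA, hB, rfl⟩ := hM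
    exact ⟨_, _, hA.relabel σ, ih hB, relabel_mul σ A B⟩

theorem Circ.parTens {J : Type} [Fintype J] {κ : J → Type} [∀ j, Fintype (κ j)]
    [∀ j, DecidableEq (κ j)] (e : (Σ j, κ j) ≃ ι) {d : ℕ} {A : ∀ j, LOp (κ j)}
    (h : ∀ j, Circ 𝒢 d (A j)) : Circ 𝒢 d (parTens e A) := by
  induction d generalizing A with
  | zero =>
    have h' : A = fun j => 1 := funext h
    rw [h', parTens_one]
    rfl
  | succ d ih =>
    choose B C hB hC hA using h
    refine ⟨_, _, Par.parTens e hB, ih hC, ?_⟩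
    rw [parTens_mul]
    congr 1
    exact funext hA

theorem Circ.list_prod {d : ℕ} {L : List (LOp ι)} (h : ∀ M ∈ L, Circ 𝒢 d M) :
    Circ 𝒢 (L.length * d) L.prod := by
  induction L with
  | nil => simp [Circ]
  | cons M L ih =>
    rw [List.length_cons, List.prod_cons, Nat.succ_mul, add_comm]
    exact (h M (by simp)).mul (ih fun N hN => h N (by simp [hN]))

end Circ

/-! ### Circuits with private auxiliary lines -/

section Slot

variable {ι : Type} {β : Type} [DecidableEq β]

/-- Every line carries a data slot `o`, the other slots being auxiliary lines with value `0`. -/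
def slot (o : β) (x : ι → Bool) : ι × β → Bool := fun p => if p.2 = o then x p.1 else false

theorem slot_self (o : β) (x : ι → Bool) (i : ι) : slot o x (i, o) = x i := if_pos rfl

theorem slot_ne {o b : β} (hb : b ≠ o) (x : ι → Bool) (i : ι) : slot o x (i, b) = false :=
  if_neg hb

theorem slot_injective (o : β) : Function.Injective (slot (ι := ι) o) := fun x y h => by
  ext i
  rw [← slot_self o x i, h, slot_self]

end Slot

section Impl

variable {𝒢 : GateSet} {ι : Type} [Fintype ι] [DecidableEq ι] {β : Type} [Fintype β]
  [DecidableEq β]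

/-- The isometry that adjoins the auxiliary lines. -/
def adjoin (ι : Type) [Fintype ι] (o : β) : Matrix (ι × β → Bool) (ι → Bool) ℂ := monoOp (slot o) 1

/-- Some circuit of depth `d` acts as `M` when the auxiliary lines are `0`. -/
def Impl (𝒢 : GateSet) (o : β) (d : ℕ) (M : LOp ι) : Prop :=
  ∃ R : LOp (ι × β), Circ 𝒢 d R ∧ R * adjoin ι o = adjoin ι o * M

theorem mul_adjoin_apply (o : β) (R : LOp (ι × β)) (w : ι × β → Bool) (x : ι → Bool) :
    (R * adjoin ι o) w x = R w (slot o x) := by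
  simp [Matrix.mul_apply, adjoin, monoOp_apply]

theorem adjoin_mul_apply (o : β) (M : LOp ι) (y x : ι → Bool) :
    (adjoin ι o * M) (slot o y) x = M y x := by
  simp [Matrix.mul_apply, adjoin, monoOp_apply, (slot_injective o).eq_iff]

/-- The intertwining relation includes the return of the auxiliary lines to `0`, so the same lines
serve again for the next factor. -/
theorem Impl.mul {o : β} {a b : ℕ} {M N : LOp ι} (hM : Impl 𝒢 o a M) (hN : Impl 𝒢 o b N) :
    Impl 𝒢 o (a + b) (M * N) := by
  obtain ⟨R, hR, hRM⟩ := hM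
  obtain ⟨T, hT, hTN⟩ := hN
  exact ⟨R * T, hR.mul hT, by
    rw [Matrix.mul_assoc, hTN, ← Matrix.mul_assoc, hRM, Matrix.mul_assoc]⟩

theorem Impl.one (h1 : 𝒢 1 1) (o : β) (d : ℕ) : Impl 𝒢 o d (1 : LOp ι) :=
  ⟨1, Circ.one h1 d, by rw [Matrix.one_mul, Matrix.mul_one]⟩

theorem Impl.list_prod {o : β} {d : ℕ} {L : List (LOp ι)} (h : ∀ M ∈ L, Impl 𝒢 o d M) :
    Impl 𝒢 o (L.length * d) L.prod := by
  induction L with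
  | nil => exact ⟨1, by simp [Circ], by simp⟩
  | cons M L ih =>
    rw [List.length_cons, List.prod_cons, Nat.succ_mul, add_comm]
    exact (h M (by simp)).mul (ih fun N hN => h N (by simp [hN]))

theorem Impl.le (h1 : 𝒢 1 1) {o : β} {a b : ℕ} (hab : a ≤ b) {M : LOp ι} (hM : Impl 𝒢 o a M) :
    Impl 𝒢 o b M := by
  obtain ⟨R, hR, hRM⟩ := hM
  exact ⟨R, hR.le h1 hab, hRM⟩

theorem Impl.mono {ℋ : GateSet} (h : ∀ k A, 𝒢 k A → ℋ k A) {o : β} {d : ℕ} {M : LOp ι}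
    (hM : Impl 𝒢 o d M) : Impl ℋ o d M := by
  obtain ⟨R, hR, hRM⟩ := hM
  exact ⟨R, hR.mono h, hRM⟩

theorem Impl.of_par (h1 : 𝒢 1 1) (o : β) {M : LOp ι} (h : Par 𝒢 M) : Impl 𝒢 o 1 M := by
  classical
  refine ⟨_, Circ.of_par (Par.extOp h1 (f := fun i => (i, o)) (fun i j h => ?_) h), ?_⟩
  · exact (Prod.ext_iff.1 h).1
  · ext w x
    rw [mul_adjoin_apply]
    simp only [extOp, Matrix.of_apply, Matrix.mul_apply, adjoin, monoOp_apply, Pi.one_apply,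
      ite_mul, one_mul, zero_mul]
    have hx : slot o x ∘ (fun i => (i, o)) = x := funext fun i => slot_self o x i
    rw [hx]
    split_ifs with hw
    · have hw' : w = slot o (w ∘ fun i => (i, o)) := by
        ext ⟨i, b⟩
        by_cases hb : b = o
        · rw [hb, slot_self]
          rfl
        · rw [slot_ne hb, hw (i, b) (fun ⟨j, hj⟩ => hb (Prod.ext_iff.1 hj).2.symm), slot_ne hb]
      rw [Finset.sum_eq_single (w ∘ fun i => (i, o)), if_pos hw']
      · intro y _ hy
        rw [if_neg]
        rintro rfl
        exact hy (funext fun i => (slot_self o y i).symm)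
      · simp
    · refine (Finset.sum_eq_zero fun y _ => if_neg ?_).symm
      rintro rfl
      refine hw ?_
      rintro ⟨i, b⟩ hi
      have hb : b ≠ o := fun hb => hi ⟨i, by rw [hb]⟩
      rw [slot_ne hb, slot_ne hb]

/-- Auxiliary lines belong to individual lines, so disjoint bundles use disjoint auxiliary lines and
`adjoin` factors over the partition. The depth does not grow with the number of bundles. -/
theorem Impl.parTens {J : Type} [Fintype J] {κ : J → Type} [∀ j, Fintype (κ j)]
    [∀ j, DecidableEq (κ j)] (e : (Σ j, κ j) ≃ ι) {o : β} {d : ℕ} {A : ∀ j, LOp (κ j)}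
    (h : ∀ j, Impl 𝒢 o d (A j)) : Impl 𝒢 o d (parTens e A) := by
  classical
  choose R hR hRA using h
  let e' : (Σ j, κ j × β) ≃ ι × β :=
    (Equiv.sigmaProdDistrib κ β).symm.trans (e.prodCongr (Equiv.refl β))
  have hE : adjoin ι o = (tens fun j => adjoin (κ j) o).submatrix (bundle e') (bundle e) := by
    unfold adjoin
    rw [tens_monoOp]
    ext w x
    simp only [Matrix.submatrix_apply, monoOp_apply, Pi.one_apply, Finset.prod_const_one]
    refine if_congr ⟨?_, fun h => (bundle e').injective ?_⟩ rfl rfl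
    · rintro rfl
      rfl
    · rw [h]
      rfl
  refine ⟨_, Circ.parTens e' hR, ?_⟩
  rw [hE, _root_.parTens, _root_.parTens, Matrix.submatrix_mul_equiv, Matrix.submatrix_mul_equiv,
    tens_mul, tens_mul]
  simp only [hRA]

/-- Composition of two implementations. -/
theorem Impl.comp {β' : Type} [Fintype β'] [DecidableEq β'] {o : β} {o' : β'} {d : ℕ}
    {M : LOp ι} {R : LOp (ι × β)} (hR : Impl 𝒢 o' d R) (hM : R * adjoin ι o = adjoin ι o * M) :
    Impl 𝒢 (o, o') d M := by
  obtain ⟨T, hT, hTR⟩ := hR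
  refine ⟨_, hT.relabel (Equiv.prodAssoc ι β β'), ?_⟩
  have h : (fun x : ι × β × β' → Bool => x ∘ Equiv.prodAssoc ι β β') =
      (Equiv.prodAssoc ι β β').symm.arrowCongr (Equiv.refl Bool) := by
    ext x i
    simp [Equiv.arrowCongr]
  have hE : adjoin ι (o, o') = (adjoin (ι × β) o' * adjoin ι o).submatrix
      ((Equiv.prodAssoc ι β β').symm.arrowCongr (Equiv.refl Bool)) (Equiv.refl _) := by
    rw [← h]
    unfold adjoin
    rw [monoOp_mul]
    ext w x
    simp only [Matrix.submatrix_apply, monoOp_apply, Pi.one_apply, mul_one]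
    have : w = slot (o, o') x ↔ w ∘ Equiv.prodAssoc ι β β' = slot o' (slot o x) := by
      simp only [funext_iff, Prod.forall, slot, Function.comp_apply, Equiv.prodAssoc_apply,
        Prod.mk.injEq, ite_and]
      refine forall_congr' fun i => forall_congr' fun b => forall_congr' fun b' => ?_
      by_cases hb : b = o <;> by_cases hb' : b' = o' <;> simp [hb, hb']
    exact if_congr this rfl rfl
  have hM' : M = M.submatrix (Equiv.refl _) (Equiv.refl _) := rfl
  rw [hE, _root_.relabel, h, Matrix.submatrix_mul_equiv]
  conv_rhs => rw [hM']
  rw [Matrix.submatrix_mul_equiv, ← Matrix.mul_assoc, hTR, Matrix.mul_assoc, hM, Matrix.mul_assoc]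

end Impl

/-! ### Simulation of one gate set by another -/

theorem LayerGates.mono {S S' : Set (Op 1)} (h : S ⊆ S') {ℰ ℰ' : GateSet}
    (h' : ∀ k A, ℰ k A → ℰ' k A) (k : ℕ) (A : Op k) (hA : LayerGates S ℰ k A) :
    LayerGates S' ℰ' k A := by
  cases hA with
  | oneQubit hU => exact .oneQubit (h hU)
  | toffoli m => exact .toffoli m
  | extra hA => exact .extra (h' _ _ hA)

/-- Every gate of `ℰ` is implemented in constant depth, with additional gates `𝒢` and a constant
number of auxiliary lines for each line. -/
def Simulates (𝒢 ℰ : GateSet) : Prop :=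
  ∃ (S : Set (Op 1)) (β : Type) (_ : Fintype β) (_ : DecidableEq β) (o : β) (d : ℕ),
    S.Finite ∧ S ⊆ Matrix.unitaryGroup (Bits 1) ℂ ∧ 1 ∈ S ∧
      ∀ k A, ℰ k A → Impl (LayerGates S 𝒢) o d A

theorem Simulates.circ {ℰ 𝒢 : GateSet} (h : Simulates 𝒢 ℰ) {S₀ : Set (Op 1)} (hfin : S₀.Finite)
    (hun : S₀ ⊆ Matrix.unitaryGroup (Bits 1) ℂ) :
    ∃ (S : Set (Op 1)) (β : Type) (_ : Fintype β) (_ : DecidableEq β) (o : β) (d : ℕ),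
      S.Finite ∧ S ⊆ Matrix.unitaryGroup (Bits 1) ℂ ∧ 1 ∈ S ∧
        ∀ (ι : Type) [Fintype ι] [DecidableEq ι] (c : ℕ) (M : LOp ι),
          Circ (LayerGates S₀ ℰ) c M → Impl (LayerGates S 𝒢) o (c * d) M := by
  obtain ⟨S, β, hβ, hβ', o, d, hS, hSu, h1, h⟩ := h
  have h1' : LayerGates (S ∪ S₀) 𝒢 1 1 := .oneQubit (Or.inl h1)
  -- The depth `d + 1` leaves one layer for the one-qubit and Toffoli gates even when `d = 0`.
  refine ⟨S ∪ S₀, β, hβ, hβ', o, d + 1, hS.union hfin, Set.union_subset hSu hun, Or.inl h1, ?_⟩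
  have gates : ∀ k A, LayerGates S₀ ℰ k A → Impl (LayerGates (S ∪ S₀) 𝒢) o (d + 1) A := by
    intro k A hA
    cases hA with
    | oneQubit hU =>
      exact (Impl.of_par h1' o (Par.gate (.oneQubit (Or.inr hU)))).le h1' (by omega)
    | toffoli m => exact (Impl.of_par h1' o (Par.gate (.toffoli m))).le h1' (by omega)
    | extra hA =>
      exact ((h _ _ hA).mono (LayerGates.mono Set.subset_union_left fun _ _ => id)).le h1'
        (by omega)
  intro ι _ _ c
  induction c with
  | zero =>
    intro M hM
    rw [Circ] at hM
    rw [hM]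
    exact Impl.one h1' _ _
  | succ c ih =>
    rintro M ⟨A, B, ⟨J, _, k, C, e, hC, rfl⟩, hB, rfl⟩
    rw [Nat.succ_mul, add_comm]
    exact (Impl.parTens e fun j => gates _ _ (hC j)).mul (ih _ hB)

/-- Depths multiply, and so do the numbers of slots per line; both stay constant. -/
theorem Simulates.trans {ℰ 𝒢 ℋ : GateSet} (h : Simulates ℋ 𝒢) (h' : Simulates 𝒢 ℰ) :
    Simulates ℋ ℰ := by
  obtain ⟨S, β, _, _, o, d, hS, hSu, h1, hg⟩ := h'
  obtain ⟨S', β', _, _, o', d', hS', hSu', h1', hc⟩ := h.circ hS hSu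
  refine ⟨S', β × β', inferInstance, inferInstance, (o, o'), d * d', hS', hSu', h1', ?_⟩
  intro k A hA
  obtain ⟨R, hR, hRA⟩ := hg k A hA
  exact (hc _ _ _ hR).comp hRA

theorem Simulates.mono {ℰ 𝒢 ℰ' 𝒢' : GateSet} (h : Simulates 𝒢 ℰ) (h𝒢 : ∀ k A, 𝒢 k A → 𝒢' k A)
    (hℰ : ∀ k A, ℰ' k A → ℰ k A) : Simulates 𝒢' ℰ' := by
  obtain ⟨S, β, _, _, o, d, hS, hSu, h1, hg⟩ := h
  exact ⟨S, β, _, _, o, d, hS, hSu, h1, fun k A hA =>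
    (hg k A (hℰ _ _ hA)).mono (LayerGates.mono subset_rfl h𝒢)⟩

/-! ### Arbitrary wirings from controlled-not layers -/

/-- On each cycle `π` acts as a rotation, and a rotation is a product of two reflections. -/
theorem Equiv.Perm.exists_mul_involutive {α : Type} (π : Equiv.Perm α) :
    ∃ σ τ : Equiv.Perm α, Function.Involutive σ ∧ Function.Involutive τ ∧ π = σ * τ := by
  let rep : α → α := fun x => (Quotient.mk (Equiv.Perm.SameCycle.setoid π) x).out
  have hrep : ∀ x, π.SameCycle (rep x) x := fun x =>
    Quotient.exact (s := Equiv.Perm.SameCycle.setoid π) (Quotient.out_eq _)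
  choose k hk using hrep
  have hrep' : ∀ x (j : ℤ), rep ((π ^ j) (rep x)) = rep x := by
    intro x j
    refine congrArg Quotient.out (Quotient.sound (s := Equiv.Perm.SameCycle.setoid π) ?_)
    exact ⟨k x - j, by rw [← Equiv.Perm.mul_apply, ← zpow_add, sub_add_cancel, hk]⟩
  -- The reflection of each cycle that fixes its chosen representative.
  let s : α → α := fun x => (π ^ (-k x)) (rep x)
  -- On a finite cycle the exponent `j` is not unique; the formula holds for every choice of it.
  have hs : ∀ x (j : ℤ), s ((π ^ j) (rep x)) = (π ^ (-j)) (rep x) := by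
    intro x j
    have h := hk ((π ^ j) (rep x))
    simp only [s]
    rw [hrep'] at h ⊢
    have h' : (π ^ (-k ((π ^ j) (rep x)))) ((π ^ j) (rep x)) = rep x := by
      generalize k ((π ^ j) (rep x)) = l at h ⊢
      rw [← h, ← Equiv.Perm.mul_apply, ← zpow_add, neg_add_cancel, zpow_zero,
        Equiv.Perm.one_apply]
    conv_rhs => rw [← h']
    rw [← Equiv.Perm.mul_apply, ← Equiv.Perm.mul_apply, ← zpow_add, ← zpow_add]
    congr 2
    ring
  have hsx : ∀ x, s x = (π ^ (-k x)) (rep x) := fun x => rfl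
  have hinv : Function.Involutive s := by
    intro x
    rw [hsx x, hs, neg_neg, hk]
  let σ : Equiv.Perm α := hinv.toPerm s
  refine ⟨σ, σ * π, hinv, ?_, ?_⟩
  · intro x
    have h1 : ∀ j : ℤ, s (π ((π ^ j) (rep x))) = (π ^ (-(1 + j))) (rep x) := by
      intro j
      rw [← hs, zpow_add, zpow_one, Equiv.Perm.mul_apply]
    change s (π (s (π x))) = x
    conv_lhs => rw [← hk x]
    rw [h1, h1]
    conv_rhs => rw [← hk x]
    congr 2
    ring
  · ext x
    exact (hinv (π x)).symm

theorem IsKron.par {𝒢 : GateSet} {N : ℕ} {M : Op N} (h : IsKron 𝒢 N M) : Par 𝒢 M := by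
  induction h with
  | nil =>
    refine ⟨Empty, inferInstance, fun _ => 0, fun j => j.elim, Equiv.equivOfIsEmpty _ _,
      fun j => j.elim, ?_⟩
    ext y x
    rw [parTens_apply, Subsingleton.elim y x]
    simp
  | @cons k N A B hA hB ih =>
    let C : ∀ b : Bool, LOp (bif b then Fin N else Fin k) := fun b => match b with
      | true => B
      | false => A
    have hC : ∀ b, Par 𝒢 (C b) := by
      rintro (_ | _)
      · exact Par.gate hA
      · exact ih
    convert Par.parTens ((Equiv.sumEquivSigmaBool (Fin k) (Fin N)).symm.trans finSumFinEquiv) hC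
    ext y x
    rw [parTens_apply, Fintype.prod_bool, mul_comm]
    rfl

theorem IsCNotLayer.par {N : ℕ} {M : Op N} (h : IsCNotLayer N M) : Par CNotGates M := by
  obtain ⟨π, D, hD, rfl⟩ := h
  exact hD.par.relabel π

theorem CNotGates.layerGates {S : Set (Op 1)} (h1 : 1 ∈ S) {ℰ : GateSet} (k : ℕ) (A : Op k)
    (h : CNotGates k A) : LayerGates S ℰ k A := by
  cases h with
  | idle => exact .oneQubit h1
  | cnot => exact .toffoli 1

/-- The identity is adjoined to `S` to account for the idle lines of controlled-not layers and to
pad the circuit to exactly `d` layers. -/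
theorem IsCircuit.circ {S : Set (Op 1)} {ℰ : GateSet} {d N : ℕ} {M : Op N}
    (h : IsCircuit S ℰ d N M) : Circ (LayerGates (insert 1 S) ℰ) d M := by
  obtain ⟨L, hL, hA, rfl⟩ := h
  refine Circ.le (.oneQubit (Set.mem_insert _ _)) hL ?_
  rw [← mul_one L.length]
  refine Circ.list_prod fun A h => Circ.of_par ?_
  rcases hA A h with h | h
  · exact h.par.mono (LayerGates.mono (Set.subset_insert _ _) fun _ _ => id)
  · exact h.par.mono (CNotGates.layerGates (Set.mem_insert _ _))

/-- Split off the first member of a family of types. -/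
def sigmaFinSuccEquiv {m : ℕ} (X : Fin (m + 1) → Type) :
    (Σ j, X j) ≃ X 0 ⊕ Σ j : Fin m, X j.succ where
  toFun p := Fin.cases (motive := fun j => X j → X 0 ⊕ Σ j : Fin m, X j.succ) Sum.inl
    (fun j i => Sum.inr ⟨j, i⟩) p.1 p.2
  invFun := Sum.elim (fun i => ⟨0, i⟩) fun p => ⟨p.1.succ, p.2⟩
  left_inv := by
    rintro ⟨j, i⟩
    cases j using Fin.cases <;> rfl
  right_inv := by rintro (i | ⟨j, i⟩) <;> rfl

theorem exists_isKron {𝒢 : GateSet} {m : ℕ} (k : Fin m → ℕ) (A : ∀ j, Op (k j))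
    (hA : ∀ j, 𝒢 (k j) (A j)) :
    ∃ (N : ℕ) (e : (Σ j, Fin (k j)) ≃ Fin N), IsKron 𝒢 N (parTens e A) := by
  induction m with
  | zero =>
    refine ⟨0, Equiv.equivOfIsEmpty _ _, ?_⟩
    convert IsKron.nil
    ext y x
    rw [parTens_apply, Subsingleton.elim y x]
    simp
  | succ m ih =>
    obtain ⟨N, e, h⟩ := ih (fun j => k j.succ) (fun j => A j.succ) fun j => hA j.succ
    refine ⟨k 0 + N, (sigmaFinSuccEquiv fun j => Fin (k j)).trans
      ((Equiv.sumCongr (Equiv.refl _) e).trans finSumFinEquiv), ?_⟩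
    convert IsKron.cons (hA 0) h
    ext y x
    rw [parTens_apply, Fin.prod_univ_succ]
    rfl

/-- Enumerating the bundles one after another places each of them on consecutive lines. -/
theorem Par.exists_isKron {𝒢 : GateSet} {N : ℕ} {M : Op N} (h : Par 𝒢 M) :
    ∃ (π : Equiv.Perm (Fin N)) (D : Op N), IsKron 𝒢 N D ∧ M = _root_.relabel π D := by
  obtain ⟨J, _, k, A, e, hA, rfl⟩ := h
  let s := (Fintype.equivFin J).symm
  obtain ⟨N', e', h⟩ := _root_.exists_isKron (fun j => k (s j)) (fun j => A (s j)) fun j => hA _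
  let t : (Σ j, Fin (k (s j))) ≃ Σ j, Fin (k j) := Equiv.sigmaCongrLeft (β := fun j => Fin (k j)) s
  obtain rfl : N' = N := by
    simpa using Fintype.card_congr ((e'.symm.trans t).trans e)
  refine ⟨(e'.symm.trans t).trans e, _, h, ?_⟩
  ext y x
  rw [parTens_apply, _root_.relabel, Matrix.submatrix_apply, parTens_apply, ← s.prod_comp]
  refine Finset.prod_congr rfl fun j _ => ?_
  have : ∀ i, ((e'.symm.trans t).trans e) (e' ⟨j, i⟩) = e ⟨s j, i⟩ := fun i => by
    simp [t, Equiv.sigmaCongrLeft_apply]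
  simp only [Function.comp_apply, this]

theorem Par.isCNotLayer {N : ℕ} {M : Op N} (h : Par CNotGates M) : IsCNotLayer N M :=
  h.exists_isKron

theorem toffoliGate_one_eq :
    toffoliGate 1 = monoOp (fun x : Bits 2 => ![x 0, xor (x 1) (x 0)]) 1 := by
  rw [toffoliGate, basisOp_eq_monoOp]
  congr 1
  ext x i
  fin_cases i <;> simp [flipLast, Fin.snoc, Fin.init, Fin.last]

/-- Controlled-nots along disjoint pairs of lines that are swapped by `σ`. -/
theorem Par.cnot {N : ℕ} {σ : Equiv.Perm (Fin N)} (hσ : Function.Involutive σ)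
    (P : Fin N → Prop) [DecidablePred P] (hP : ∀ i, P i → ¬ P (σ i)) :
    Par CNotGates
      (monoOp (fun (x : Bits N) i => if P (σ i) then xor (x i) (x (σ i)) else x i) 1) := by
  have hg : ∀ _ : {i // P i}, CNotGates 2
      (monoOp (fun x : Bits 2 => ![x 0, xor (x 1) (x 0)]) 1) := fun _ => by
    rw [← toffoliGate_one_eq]
    exact .cnot
  have h := Par.of_monoOp (𝒢 := CNotGates) .idle _ _ hg (fun j => ![j.1, σ j.1]) ?_
    (fun (x : Bits N) i => if P (σ i) then xor (x i) (x (σ i)) else x i) ?_ ?_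
  · simpa [Pi.one_def] using h
  · rintro ⟨j, hj⟩ i ⟨j', hj'⟩ i' hij
    have key : ∀ a b, P a → P b → a ≠ σ b := fun a b ha hb h => hP b hb (h ▸ ha)
    fin_cases i <;> fin_cases i' <;> simp at hij
    · subst hij
      rfl
    · exact absurd hij (key _ _ hj hj')
    · exact absurd hij.symm (key _ _ hj' hj)
    · subst hij
      rfl
  · rintro x ⟨j, hj⟩ i
    fin_cases i
    · simp [hP j hj]
    · simp [hσ j, hj]
  · intro x i hi
    refine if_neg fun h => ?_
    exact hi ⟨σ i, h⟩ 1 (by simp [hσ i])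

/-- Permute the lines. -/
def permOp {N : ℕ} (π : Equiv.Perm (Fin N)) : Op N := monoOp (fun x => x ∘ π) 1

theorem permOp_mul {N : ℕ} (σ τ : Equiv.Perm (Fin N)) :
    permOp (σ * τ) = permOp τ * permOp σ := by
  rw [permOp, permOp, permOp, monoOp_mul]
  congr 1
  ext x
  simp

theorem relabel_eq {N : ℕ} (π : Equiv.Perm (Fin N)) (D : Op N) :
    relabel π D = permOp π⁻¹ * D * permOp π := by
  ext y x
  have h : ∀ w : Bits N, y = w ∘ ⇑π⁻¹ ↔ w = y ∘ π := fun w =>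
    ⟨by rintro rfl; ext i; simp, by rintro rfl; ext i; simp⟩
  simp only [relabel, permOp, Matrix.mul_apply, monoOp_apply, h]
  simp

/-- The exchange of two bits by three XORs, carried out on all transposed pairs at once. The order
on the lines selects the control in each pair. -/
theorem isCircuit_permOp_of_involutive (S : Set (Op 1)) (ℰ : GateSet) {N : ℕ}
    {σ : Equiv.Perm (Fin N)} (hσ : Function.Involutive σ) : IsCircuit S ℰ 3 N (permOp σ) := by
  have h1 := Par.cnot hσ (fun i => i < σ i) fun i hi h => by
    rw [hσ i] at h
    exact lt_asymm hi h
  have h2 := Par.cnot hσ (fun i => σ i < i) fun i hi h => by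
    rw [hσ i] at h
    exact lt_asymm hi h
  set A := monoOp (fun (x : Bits N) i => if σ i < σ (σ i) then x i ^^ x (σ i) else x i) 1 with hA
  set B := monoOp (fun (x : Bits N) i => if σ (σ i) < σ i then x i ^^ x (σ i) else x i) 1 with hB
  refine ⟨[A, B, A], le_rfl, fun C hC => ?_, ?_⟩
  · rw [List.mem_cons, List.mem_cons, List.mem_singleton] at hC
    rcases hC with h | h | h
    · exact h ▸ Or.inr h1.isCNotLayer
    · exact h ▸ Or.inr h2.isCNotLayer
    · exact h ▸ Or.inr h1.isCNotLayer
  · rw [List.prod_cons, List.prod_cons, List.prod_singleton, hA, hB, monoOp_mul, monoOp_mul, permOp]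
    congr 1
    · ext x i
      simp only [Function.comp_apply, hσ i]
      rcases lt_trichotomy (σ i) i with h | h | h
      · simp [h, h.not_gt]
      · simp [h]
      · simp only [h, h.not_gt, if_true, if_false]
        cases x i <;> cases x (σ i) <;> rfl
    · ext x
      simp

theorem IsCircuit.mul {S : Set (Op 1)} {ℰ : GateSet} {a b N : ℕ} {A B : Op N}
    (hA : IsCircuit S ℰ a N A) (hB : IsCircuit S ℰ b N B) : IsCircuit S ℰ (a + b) N (A * B) := by
  obtain ⟨L, hL, hL', rfl⟩ := hA
  obtain ⟨K, hK, hK', rfl⟩ := hB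
  refine ⟨L ++ K, by simp; omega, fun A hA => ?_, by simp⟩
  rcases List.mem_append.1 hA with h | h
  · exact hL' A h
  · exact hK' A h

theorem isCircuit_permOp (S : Set (Op 1)) (ℰ : GateSet) {N : ℕ} (π : Equiv.Perm (Fin N)) :
    IsCircuit S ℰ 6 N (permOp π) := by
  obtain ⟨σ, τ, hσ, hτ, rfl⟩ := π.exists_mul_involutive
  rw [permOp_mul]
  exact (isCircuit_permOp_of_involutive S ℰ hτ).mul (isCircuit_permOp_of_involutive S ℰ hσ)

/-- A parallel layer is a Kronecker layer conjugated by a permutation: `13 = 6 + 1 + 6`. -/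
theorem Circ.isCircuit {S : Set (Op 1)} {ℰ : GateSet} {d N : ℕ} {M : Op N}
    (h : Circ (LayerGates S ℰ) d M) : IsCircuit S ℰ (d * 13) N M := by
  induction d generalizing M with
  | zero =>
    rw [Circ] at h
    exact ⟨[], by simp, by simp, by simp [h]⟩
  | succ d ih =>
    obtain ⟨A, B, hA, hB, rfl⟩ := h
    obtain ⟨π, D, hD, rfl⟩ := hA.exists_isKron
    rw [Nat.succ_mul, add_comm, relabel_eq]
    have hD' : IsCircuit S ℰ 1 N D := 
      ⟨[D], le_rfl, fun A hA => Or.inl (List.mem_singleton.1 hA ▸ hD), by simp⟩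
    exact (((isCircuit_permOp S ℰ π⁻¹).mul hD').mul (isCircuit_permOp S ℰ π)).mul (ih hB)

/-! ### From simulation to reducibility -/

/-- A family with constant-depth circuits over gates which the operators of `G` simulate is
reducible to `G`. -/
theorem Simulates.reducible {ℰ : GateSet} {F G : OpFamily} (h : Simulates (FamilyGates G) ℰ)
    (hF : ConstDepth ℰ F.width fun n => F.op n) : QAC0Reducible F G := by
  obtain ⟨S₀, c, hfin, hun, hc⟩ := hF
  obtain ⟨S, β, _, _, o, d, hS, hSu, h1, himp⟩ := h.circ (hfin.insert 1)
    (Set.insert_subset (one_mem (Matrix.unitaryGroup (Bits 1) ℂ)) hun)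
  choose R hR hRF using fun n => himp _ c _ (hc n).circ
  obtain ⟨p, hp⟩ := F.width_poly
  -- Every line of `F` brings one auxiliary line for each slot other than `o`.
  let r : Polynomial ℕ := (Polynomial.X + p) * Polynomial.C (Fintype.card {b : β // b ≠ o})
  have hr : ∀ n, Fintype.card (Fin (F.width n) × {b : β // b ≠ o}) = r.eval n := by
    intro n
    simp [r, hp n]
  let a : ∀ n, Fin (F.width n) × {b : β // b ≠ o} ≃ Fin (r.eval n) := fun n =>
    Fintype.equivFinOfCardEq (hr n)
  let g : ∀ n, Fin (F.width n) × β → Fin (F.width n + r.eval n) := fun n p =>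
    if hb : p.2 = o then Fin.castAdd _ p.1 else Fin.natAdd _ (a n (p.1, ⟨p.2, hb⟩))
  have g1 : ∀ n i, g n (i, o) = Fin.castAdd _ i := fun n i => dif_pos rfl
  have g2 : ∀ n i b (hb : b ≠ o), g n (i, b) = Fin.natAdd _ (a n (i, ⟨b, hb⟩)) :=
    fun n i b hb => dif_neg hb
  have hg : ∀ n, Function.Bijective (g n) := by
    intro n
    rw [Fintype.bijective_iff_surjective_and_card]
    constructor
    · intro i
      refine Fin.addCases (fun i => ⟨(i, o), g1 n i⟩) (fun i => ?_) i
      obtain ⟨⟨j, b, hb⟩, rfl⟩ := (a n).surjective i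
      exact ⟨(j, b), g2 n j b hb⟩
    · have hcard : 1 ≤ Fintype.card β := Fintype.card_pos_iff.2 ⟨o⟩
      rw [Fintype.card_prod, Fintype.card_fin, Fintype.card_fin, ← hr n, Fintype.card_prod,
        Fintype.card_fin]
      simp only [ne_eq, Fintype.card_subtype_compl, Fintype.card_unique]
      rw [← Nat.add_sub_cancel' hcard, Nat.mul_add, mul_one, Nat.add_sub_cancel_left]
  let σ := fun n => Equiv.ofBijective (g n) (hg n)
  refine ⟨r, fun n => relabel (σ n) (R n), ⟨S, c * d * 13, hS, hSu, fun n => ?_⟩, fun n => ?_⟩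
  · exact ((hR n).relabel (σ n)).isCircuit
  · refine ⟨fun _ => false, fun x y => ?_⟩
    have hx : ∀ x : Bits (F.width n),
        Fin.append x (fun _ : Fin (r.eval n) => false) ∘ σ n = slot o x := by
      intro x
      ext ⟨i, b⟩
      simp only [Function.comp_apply, σ, Equiv.ofBijective_apply]
      by_cases hb : b = o
      · rw [hb, g1, slot_self, Fin.append_left]
      · rw [g2 n i b hb, slot_ne hb, Fin.append_right]
    change _ = R n (_ ∘ σ n) (_ ∘ σ n)
    rw [hx, hx]
    exact (adjoin_mul_apply o _ y x).symm.trans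
      ((congrFun (congrFun (hRF n) _) _).symm.trans (mul_adjoin_apply o _ _ _))

/-! ### One-qubit algebra: producing `X` from phases -/

/-- The `2 × 2` matrix with the given entries. -/
def qubitMatrix (a b c d : ℂ) : Matrix Bool Bool ℂ :=
  Matrix.of fun i j => bif i then (bif j then d else c) else (bif j then b else a)

theorem qubitMatrix_mul (a b c d a' b' c' d' : ℂ) :
    qubitMatrix a b c d * qubitMatrix a' b' c' d' =
      qubitMatrix (a * a' + b * c') (a * b' + b * d') (c * a' + d * c') (c * b' + d * d') := by
  ext (_ | _) (_ | _) <;> simp [qubitMatrix, Matrix.mul_apply, add_comm]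

theorem qubitMatrix_star (a b c d : ℂ) :
    star (qubitMatrix a b c d) = qubitMatrix (star a) (star c) (star b) (star d) := by
  ext (_ | _) (_ | _) <;> simp [qubitMatrix, Matrix.star_apply]

theorem qubitMatrix_one : qubitMatrix 1 0 0 1 = 1 := by
  ext (_ | _) (_ | _) <;> simp [qubitMatrix]

theorem qubitMatrix_smul (z a b c d : ℂ) :
    z • qubitMatrix a b c d = qubitMatrix (z * a) (z * b) (z * c) (z * d) := by
  ext (_ | _) (_ | _) <;> simp [qubitMatrix]

/-- The one-qubit phase gate. -/
def qubitPhase (z : ℂ) : Matrix Bool Bool ℂ := qubitMatrix 1 0 0 z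

/-- The one-qubit gate `X`. -/
def qubitNot : Matrix Bool Bool ℂ := qubitMatrix 0 1 1 0

theorem qubitPhase_mul (z w : ℂ) : qubitPhase z * qubitPhase w = qubitPhase (z * w) := by
  simp [qubitPhase, qubitMatrix_mul]

theorem qubitPhase_one : qubitPhase 1 = 1 := qubitMatrix_one

theorem star_qubitPhase (z : ℂ) : star (qubitPhase z) = qubitPhase (star z) := by
  simp [qubitPhase, qubitMatrix_star]

theorem qubitPhase_eq_monoOp (z : ℂ) :
    qubitPhase z = monoOp id fun b => if b = true then z else 1 := by
  ext (_ | _) (_ | _) <;> simp [qubitPhase, qubitMatrix, monoOp_apply]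

theorem qubitNot_eq_monoOp : qubitNot = monoOp not 1 := by
  ext (_ | _) (_ | _) <;> simp [qubitNot, qubitMatrix, monoOp_apply]

theorem qubitPhase_mem {z : ℂ} (hz : z * star z = 1) :
    qubitPhase z ∈ Matrix.unitaryGroup Bool ℂ := by
  rw [Matrix.mem_unitaryGroup_iff, star_qubitPhase, qubitPhase_mul, hz, qubitPhase_one]

theorem qubitNot_mem : qubitNot ∈ Matrix.unitaryGroup Bool ℂ := by
  rw [Matrix.mem_unitaryGroup_iff, qubitNot, qubitMatrix_star, qubitMatrix_mul, ← qubitMatrix_one]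
  simp

/-- Every traceless Hermitian unitary `2 × 2` matrix is conjugate to `X`. -/
theorem exists_conj_eq_qubitNot {p w v : ℂ} (hp : star p = p) (hw : star w = v)
    (h : p * p + w * v = 1) : ∃ A ∈ Matrix.unitaryGroup Bool ℂ,
      A * qubitMatrix p w v (-p) * star A = qubitNot := by
  have hv : star v = w := by rw [← hw, star_star]
  obtain ⟨P, rfl⟩ : ∃ P : ℝ, (P : ℂ) = p := Complex.conj_eq_iff_real.1 hp |>.imp fun _ h => h.symm
  have hnorm : P ^ 2 + (w.re ^ 2 + w.im ^ 2) = 1 := by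
    have : w * v = ((w.re ^ 2 + w.im ^ 2 : ℝ) : ℂ) := by
      rw [← hw, Complex.star_def, Complex.mul_conj, Complex.normSq_apply]
      congr 1
      ring
    rw [this] at h
    have h' : ((P ^ 2 + (w.re ^ 2 + w.im ^ 2) : ℝ) : ℂ) = 1 := by
      rw [← h]
      push_cast
      ring
    exact_mod_cast h'
  have hwv : w + v = ((2 * w.re : ℝ) : ℂ) := by
    rw [← hw, Complex.star_def, Complex.add_conj]
  by_cases hre : w.re = -1
  -- Here the matrix is `-X`, so its sum with `X` vanishes and cannot be normalised; conjugation by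
  -- `Z` works instead.
  · rw [hre] at hnorm hwv
    have hP : P = 0 := by nlinarith [sq_nonneg P, sq_nonneg w.im]
    have hi : w.im = 0 := by nlinarith [sq_nonneg P, sq_nonneg w.im]
    have hw1 : w = -1 := Complex.ext (by simp [hre]) (by simp [hi])
    have hv1 : v = -1 := by rw [← hw, hw1]; simp
    refine ⟨qubitPhase (-1), qubitPhase_mem (by simp), ?_⟩
    rw [star_qubitPhase, qubitPhase, qubitPhase, qubitMatrix_mul, qubitMatrix_mul, hw1, hv1, hP,
      qubitNot]
    congr 1 <;> simp
  · have hpos : 0 < 2 + 2 * w.re := by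
      have h1 : -1 ≤ w.re := by nlinarith [sq_nonneg P, sq_nonneg w.im]
      have h2 : -1 < w.re := lt_of_le_of_ne h1 (Ne.symm hre)
      linarith
    -- With `H` the given matrix, `A` is the multiple `n (H + X)`. It works because `(H + X)² = 2 +
    -- w + v` is scalar and `(H + X) H = 1 + X H = X (H + X)`.
    let n : ℝ := (Real.sqrt (2 + 2 * w.re))⁻¹
    have hn : (n : ℂ) * n * (2 + (w + v)) = 1 := by
      rw [hwv]
      have : n * n * (2 + 2 * w.re) = 1 := by
        simp only [n]
        rw [← mul_inv, Real.mul_self_sqrt hpos.le, inv_mul_cancel₀ hpos.ne']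
      exact_mod_cast this
    have hns : star (n : ℂ) = n := Complex.conj_ofReal n
    have hsa : star (qubitMatrix (n * P) (n * (w + 1)) (n * (v + 1)) (n * -P)) =
        qubitMatrix (n * P) (n * (w + 1)) (n * (v + 1)) (n * -P) := by
      rw [qubitMatrix_star]
      simp only [star_mul', star_add, star_neg, star_one, hns, hw, hv, hp]
    refine ⟨qubitMatrix (n * P) (n * (w + 1)) (n * (v + 1)) (n * -P), ?_, ?_⟩
    · rw [Matrix.mem_unitaryGroup_iff, hsa, qubitMatrix_mul, ← qubitMatrix_one]
      congr 1
      · linear_combination (n : ℂ) ^ 2 * h + hn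
      · ring
      · ring
      · linear_combination (n : ℂ) ^ 2 * h + hn
    · rw [hsa, qubitMatrix_mul, qubitMatrix_mul, qubitNot]
      have e1 : (n : ℂ) * P * P + n * (w + 1) * v = n * (1 + v) := by
        linear_combination (n : ℂ) * h
      have e2 : (n : ℂ) * (v + 1) * w + n * -P * -P = n * (1 + w) := by
        linear_combination (n : ℂ) * h
      rw [e1, e2]
      congr 1
      · ring
      · linear_combination (n : ℂ) ^ 2 * h + hn
      · linear_combination (n : ℂ) ^ 2 * h + hn
      · ring

/-- For `Re δ ≤ 0`, the phase gate of `δ` and its inverse yield `X` up to a phase in a sequence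
of gates that collapses to the identity when they are left out. -/
theorem exists_commutator_eq_qubitNot {δ : ℂ} (hδ : δ * star δ = 1) (hre : δ.re ≤ 0) :
    ∃ A ∈ Matrix.unitaryGroup Bool ℂ, ∃ B ∈ Matrix.unitaryGroup Bool ℂ,
      A * qubitPhase δ * B * qubitPhase (star δ) * (star B * star A) = Complex.I • qubitNot := by
  have hpos : 0 < 1 - δ.re := by linarith
  -- `a` and `s` are the cosine and sine of the rotation `B`. They solve `2 a² + s² (δ + star δ) =
  -- 0`, the vanishing of the trace of `P(δ) B P(δ)* B*`; a real solution requires `Re δ ≤ 0`.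
  let s : ℝ := (Real.sqrt (1 - δ.re))⁻¹
  let a : ℝ := Real.sqrt (-δ.re) * s
  have hs : s * s * (1 - δ.re) = 1 := by
    simp only [s]
    rw [← mul_inv, Real.mul_self_sqrt hpos.le, inv_mul_cancel₀ hpos.ne']
  have ha : a * a = -δ.re * (s * s) := by
    simp only [a]
    rw [mul_mul_mul_comm, Real.mul_self_sqrt (by linarith)]
  have hre2 : δ + star δ = 2 * (δ.re : ℂ) := by
    rw [Complex.star_def, Complex.add_conj]
    push_cast
    ring
  have hs' : (s : ℂ) * s * (2 - (δ + star δ)) = 2 := by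
    rw [hre2]
    have : ((s * s * (1 - δ.re) : ℝ) : ℂ) = 1 := by rw [hs, Complex.ofReal_one]
    push_cast at this
    linear_combination 2 * this
  have ha' : 2 * ((a : ℂ) * a) = -(δ + star δ) * (s * s) := by
    rw [hre2]
    have : ((a * a : ℝ) : ℂ) = ((-δ.re * (s * s) : ℝ) : ℂ) := by rw [ha]
    push_cast at this
    linear_combination 2 * this
  have has : (a : ℂ) * a + s * s = 1 := by linear_combination ha' / 2 + hs' / 2
  have ss : star (s : ℂ) = s := Complex.conj_ofReal s
  have sa : star (a : ℂ) = a := Complex.conj_ofReal a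
  have sI : star Complex.I = -Complex.I := Complex.conj_I
  have hI := Complex.I_mul_I
  generalize hε : star δ = ε at *
  have hε' : star ε = δ := by rw [← hε, star_star]
  generalize (s : ℂ) = s, (a : ℂ) = a at *
  have hB : star (qubitMatrix a (-s) s a) = qubitMatrix a s (-s) a := by
    rw [qubitMatrix_star, star_neg, ss, sa]
  have hBu : qubitMatrix a (-s) s a ∈ Matrix.unitaryGroup Bool ℂ := by
    rw [Matrix.mem_unitaryGroup_iff, hB, qubitMatrix_mul, ← qubitMatrix_one]
    congr 1
    · linear_combination has
    · ring
    · ring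
    · linear_combination has
  -- A unitary commutator of trace `0` and determinant `1` has eigenvalues `±i`, so `-i` times it is
  -- Hermitian, unitary and traceless, as needed for the conjugation to `X`.
  have hp : star (-Complex.I * (a * a + s * s * ε)) = -Complex.I * (a * a + s * s * ε) := by
    simp only [star_mul', star_add, star_neg, ss, sa, sI, hε']
    linear_combination Complex.I * ha'
  have hw : star (-Complex.I * (a * s * (1 - ε))) = -Complex.I * (a * s * (δ - 1)) := by
    simp only [star_mul', star_sub, star_neg, star_one, ss, sa, sI, hε']
    ring
  have hpw : -Complex.I * (a * a + s * s * ε) * (-Complex.I * (a * a + s * s * ε)) +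
      -Complex.I * (a * s * (1 - ε)) * (-Complex.I * (a * s * (δ - 1))) = 1 := by
    have e1 : a * a + s * s * ε = s * s * (ε - δ) / 2 := by linear_combination ha' / 2
    have e2 : (s * s * (ε - δ) / 2) ^ 2 = a * a - s * s := by
      linear_combination -s ^ 4 * hδ - s * s * (δ + ε + 2) / 4 * hs' - ha' / 2
    rw [e1]
    linear_combination (s * s * (ε - δ) / 2) ^ 2 * hI - e2 +
      a * a * s * s * (1 - ε) * (δ - 1) * hI + a * a * s * s * hδ + a * a * hs' + has
  obtain ⟨A, hA, hAX⟩ := exists_conj_eq_qubitNot hp hw hpw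
  refine ⟨A, hA, _, hBu, ?_⟩
  rw [← hAX, ← Matrix.smul_mul, ← Matrix.mul_smul, qubitMatrix_smul, hB]
  have : qubitMatrix (Complex.I * (-Complex.I * (a * a + s * s * ε)))
      (Complex.I * (-Complex.I * (a * s * (1 - ε))))
      (Complex.I * (-Complex.I * (a * s * (δ - 1))))
      (Complex.I * -(-Complex.I * (a * a + s * s * ε))) =
      qubitPhase δ * qubitMatrix a (-s) s a * qubitPhase ε * qubitMatrix a s (-s) a := by
    rw [qubitPhase, qubitPhase, qubitMatrix_mul, qubitMatrix_mul, qubitMatrix_mul]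
    congr 1
    · linear_combination -(a * a + s * s * ε) * hI
    · linear_combination -(a * s * (1 - ε)) * hI
    · linear_combination -(a * s * (δ - 1)) * hI + a * s * hδ
    · linear_combination (a * a + s * s * ε) * hI - a * a * hδ - ha'
  rw [this]
  simp only [Matrix.mul_assoc]

/-- A phase with `t`-th power `1`, whose `k`-th power has nonpositive real part. -/
theorem exists_pow_eq_one_re_pow_nonpos {t k : ℕ} (hk : 0 < k) (hkt : k < t) :
    ∃ δ : ℂ, δ ^ t = 1 ∧ (δ ^ k).re ≤ 0 := by
  have ht : t ≠ 0 := by omega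
  have hζ := Complex.isPrimitiveRoot_exp t ht
  generalize Complex.exp (2 * Real.pi * Complex.I / t) = ζ at hζ
  have h1 : ζ ^ k ≠ 1 := hζ.pow_ne_one_of_pos_of_lt hk.ne' hkt
  -- The candidates are `δ = ζ ^ m`. Their `k`-th powers sum to `0`, so they cannot all have
  -- positive real part.
  have hsum : ∑ m ∈ Finset.range t, (ζ ^ k) ^ m = 0 := by
    have := geom_sum_mul (ζ ^ k) t
    rw [← pow_mul, mul_comm k t, pow_mul, hζ.pow_eq_one, one_pow, sub_self] at this
    exact (mul_eq_zero.1 this).resolve_right (sub_ne_zero.2 h1)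
  by_contra! hcon
  have h2 : 0 < ∑ m ∈ Finset.range t, ((ζ ^ k) ^ m).re := by
    refine Finset.sum_pos (fun m _ => ?_) (by simpa using ht)
    rw [← pow_mul, mul_comm, pow_mul]
    exact hcon _ (by rw [← pow_mul, mul_comm, pow_mul, hζ.pow_eq_one, one_pow])
  rw [← Complex.re_sum, hsum] at h2
  simp at h2

theorem mul_star_eq_one_of_pow_eq_one {z : ℂ} {n : ℕ} (hn : n ≠ 0) (h : z ^ n = 1) :
    z * star z = 1 := by
  rw [Complex.star_def, Complex.mul_conj, Complex.normSq_eq_norm_sq,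
    Complex.norm_eq_one_of_pow_eq_one h hn]
  simp

/-! ### One-qubit layers and controlled flips -/

/-- A `2 × 2` matrix as an operator on one line. -/
def oneQubitOp (U : Matrix Bool Bool ℂ) : Op 1 := U.submatrix (fun x => x 0) (fun x => x 0)

theorem oneQubitOp_one : oneQubitOp 1 = 1 := by
  ext y x
  have : y 0 = x 0 ↔ y = x := ⟨fun h => funext fun i => by rwa [Subsingleton.elim i 0],
    fun h => h ▸ rfl⟩
  simp [oneQubitOp, Matrix.one_apply, this]

theorem oneQubitOp_mem {U : Matrix Bool Bool ℂ} (hU : U ∈ Matrix.unitaryGroup Bool ℂ) :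
    oneQubitOp U ∈ Matrix.unitaryGroup (Bits 1) ℂ := by
  rw [Matrix.mem_unitaryGroup_iff, Matrix.star_eq_conjTranspose] at hU ⊢
  have h : oneQubitOp U = U.submatrix (Equiv.funUnique (Fin 1) Bool)
    (Equiv.funUnique (Fin 1) Bool) := rfl
  rw [h, Matrix.conjTranspose_submatrix, Matrix.submatrix_mul_equiv, hU, Matrix.submatrix_one_equiv]

theorem Par.tens {S : Set (Op 1)} {ℰ : GateSet} {ι : Type} [Fintype ι]
    {U : ι → Matrix Bool Bool ℂ} (h : ∀ i, oneQubitOp (U i) ∈ S) :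
    Par (LayerGates S ℰ) (tens U : LOp ι) :=
  Par.parTens (A := fun i => oneQubitOp (U i)) (Equiv.sigmaUnique ι fun _ => Fin 1)
    fun i => Par.gate (LayerGates.oneQubit (h i))

theorem Par.tens_phase {S : Set (Op 1)} {ℰ : GateSet} {ι : Type} [Fintype ι] {z : ι → ℂ}
    (h : ∀ i, oneQubitOp (qubitPhase (z i)) ∈ S) :
    Par (LayerGates S ℰ)
      (monoOp id fun x : ι → Bool => ∏ i, if x i = true then z i else 1) := by
  have := Par.tens (ℰ := ℰ) h
  simp only [qubitPhase_eq_monoOp] at this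
  rwa [tens_monoOp] at this

theorem Par.tens_not {S : Set (Op 1)} {ℰ : GateSet} {ι : Type} [Fintype ι]
    (h1 : 1 ∈ S) (h : oneQubitOp qubitNot ∈ S) (P : ι → Prop) [DecidablePred P] :
    Par (LayerGates S ℰ) (monoOp (fun (x : ι → Bool) i => if P i then !x i else x i) 1) := by
  have h' : ∀ i, oneQubitOp (monoOp (if P i then not else id) 1) ∈ S := by
    intro i
    split_ifs
    · rwa [← qubitNot_eq_monoOp]
    · rwa [← one_eq_monoOp, oneQubitOp_one]
  have := Par.tens (ℰ := ℰ) h'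
  rw [tens_monoOp] at this
  convert this using 2
  · ext x i
    split_ifs <;> rfl
  · ext x
    simp

theorem Par.flip {𝒢 : GateSet} (h1 : 𝒢 1 1) {ι : Type} [Fintype ι] [DecidableEq ι] {m : ℕ}
    {c : Bits m → Bool} (hc : 𝒢 (m + 1) (basisOp (flipLast c))) {f : Fin m → ι}
    (hf : Function.Injective f) {t : ι} (ht : ∀ j, f j ≠ t) :
    Par 𝒢 (monoOp (fun x : ι → Bool => Function.update x t (xor (x t) (c (x ∘ f)))) 1) := by
  have hinit : ∀ x : ι → Bool,
      Fin.init (α := fun _ => Bool) (x ∘ (Fin.snoc (α := fun _ => ι) f t)) = x ∘ f := by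
    intro x
    ext j
    simp [Fin.init]
  have := Par.of_monoOp_single h1 (g := flipLast c) (c := 1) hc
    (f := Fin.snoc (α := fun _ => ι) f t) ?_
    (F := fun x => Function.update x t (xor (x t) (c (x ∘ f)))) ?_ ?_
  · exact this
  · intro i j
    refine Fin.lastCases ?_ (fun i => ?_) i <;> refine Fin.lastCases ?_ (fun j => ?_) j
    · simp
    · simpa using fun h => absurd h.symm (ht j)
    · simpa using fun h => absurd h (ht i)
    · simpa using fun h => hf h
  · intro x i
    rw [flipLast, hinit]
    refine Fin.lastCases ?_ (fun i => ?_) i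
    · simp
    · simp [Function.update_of_ne (ht i)]
  · intro x i hi
    refine Function.update_of_ne (fun h => hi (Fin.last m) ?_) _ _
    simp [h]

/-! ### Phase gates from fan-out and from `MOD_q` -/

/-- The gate `|x₁, …, x_m, b⟩ ↦ δ ^ (b (x₁ + ⋯ + x_m)) |x₁, …, x_m, b⟩`. -/
def phaseGate (δ : ℂ) (m : ℕ) : Op (m + 1) :=
  monoOp id fun x => if x (Fin.last m) = true then δ ^ (∑ j : Fin m, (x j.castSucc).toNat) else 1

/-- The phase gates with `δ ^ q = 1`. -/
inductive PhaseGates (q : ℕ) : GateSet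
  | mk (δ : ℂ) (h : δ ^ q = 1) (m : ℕ) : PhaseGates q (m + 1) (phaseGate δ m)

/-- Compute a phase into auxiliary lines, and uncompute. -/
theorem Impl.diag {𝒢 : GateSet} {ι β : Type} [Fintype ι] [DecidableEq ι] [Fintype β]
    [DecidableEq β] {o : β} {a b : ℕ} {F F' : (ι × β → Bool) → ι × β → Bool}
    (hF : Circ 𝒢 a (monoOp F 1)) (hF' : Circ 𝒢 b (monoOp F' 1)) {C : (ι × β → Bool) → ℂ}
    (hC : Par 𝒢 (monoOp id C)) (hinv : ∀ x, F' (F x) = x) :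
    Impl 𝒢 o (b + (1 + a)) (monoOp id fun x : ι → Bool => C (F (slot o x))) := by
  refine ⟨_, hF'.mul ((Circ.of_par hC).mul hF), ?_⟩
  rw [adjoin, monoOp_mul, monoOp_mul, monoOp_mul, monoOp_mul]
  congr 1
  · ext x : 1
    exact hinv _
  · ext x
    simp

theorem monoOp_one_mul {X Y Z : Type} [DecidableEq Y] [DecidableEq Z] [Fintype Y] (f : Y → Z)
    (g : X → Y) : monoOp f 1 * monoOp g 1 = monoOp (f ∘ g) 1 := by
  rw [monoOp_mul]
  congr 1
  ext x
  simp

theorem Circ.comp {𝒢 : GateSet} {ι : Type} [Fintype ι] [DecidableEq ι] {a b : ℕ}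
    {F G : (ι → Bool) → ι → Bool} (hF : Circ 𝒢 a (monoOp F 1)) (hG : Circ 𝒢 b (monoOp G 1)) :
    Circ 𝒢 (a + b) (monoOp (fun x => F (G x)) 1) := by
  have := hF.mul hG
  rwa [monoOp_one_mul] at this

theorem finite_phases {q : ℕ} (hq : 0 < q) :
    {U : Op 1 | ∃ δ : ℂ, δ ^ q = 1 ∧ U = oneQubitOp (qubitPhase δ)}.Finite := by
  have : {δ : ℂ | δ ^ q = 1}.Finite := by
    refine (Polynomial.nthRootsFinset q (1 : ℂ)).finite_toSet.subset fun δ hδ => ?_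
    exact (Polynomial.mem_nthRootsFinset hq 1).2 hδ
  refine (this.image fun δ => oneQubitOp (qubitPhase δ)).subset ?_
  rintro U ⟨δ, hδ, rfl⟩
  exact ⟨δ, hδ, rfl⟩

/-- The one-qubit gates `1`, `X` and the phase gates of order dividing `q`. -/
def phaseGateSet (q : ℕ) : Set (Op 1) :=
  insert 1 (insert (oneQubitOp qubitNot)
    {U : Op 1 | ∃ δ : ℂ, δ ^ q = 1 ∧ U = oneQubitOp (qubitPhase δ)})

theorem phaseGateSet_finite {q : ℕ} (hq : 0 < q) : (phaseGateSet q).Finite :=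
  ((finite_phases hq).insert _).insert _

theorem phaseGateSet_subset {q : ℕ} (hq : 0 < q) :
    phaseGateSet q ⊆ Matrix.unitaryGroup (Bits 1) ℂ := by
  rintro U (rfl | rfl | ⟨δ, hδ, rfl⟩)
  · exact one_mem (Matrix.unitaryGroup (Bits 1) ℂ)
  · exact oneQubitOp_mem qubitNot_mem
  · exact oneQubitOp_mem (qubitPhase_mem (mul_star_eq_one_of_pow_eq_one hq.ne' hδ))

theorem one_mem_phaseGateSet (q : ℕ) : 1 ∈ phaseGateSet q := Or.inl rfl

theorem not_mem_phaseGateSet (q : ℕ) : oneQubitOp qubitNot ∈ phaseGateSet q := Or.inr (Or.inl rfl)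

theorem phase_mem_phaseGateSet {q : ℕ} {δ : ℂ} (h : δ ^ q = 1) :
    oneQubitOp (qubitPhase δ) ∈ phaseGateSet q := Or.inr (Or.inr ⟨δ, h, rfl⟩)

/-- Fan-out yields the phase gates: copy `b`, form the products `b xⱼ`, and apply a phase to each. -/
theorem fanout_simulates_phase {q : ℕ} (hq : 0 < q) : Simulates FanoutGates (PhaseGates q) := by
  -- Slot `0` holds data, slot `1` copies of `b`, slot `2` the products. Depth `5`: two layers to
  -- compute, one for the phases, two to uncompute.
  refine ⟨phaseGateSet q, Fin 3, inferInstance, inferInstance, 0, 5, phaseGateSet_finite hq,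
    phaseGateSet_subset hq, one_mem_phaseGateSet q, ?_⟩
  rintro _ _ ⟨δ, hδ, n⟩
  set 𝒢 := LayerGates (phaseGateSet q) FanoutGates
  have h1 : 𝒢 1 1 := .oneQubit (one_mem_phaseGateSet q)
  let F₁ : (Fin (n + 1) × Fin 3 → Bool) → Fin (n + 1) × Fin 3 → Bool := fun x p =>
    if p.2 = 1 ∧ p.1 ≠ Fin.last n then xor (x p) (x (Fin.last n, 0)) else x p
  let F₂ : (Fin (n + 1) × Fin 3 → Bool) → Fin (n + 1) × Fin 3 → Bool := fun x p =>
    if p.2 = 2 ∧ p.1 ≠ Fin.last n then xor (x p) (x (p.1, 0) && x (p.1, 1)) else x p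
  have hF₁ : Par 𝒢 (monoOp F₁ 1) := by
    refine Par.of_monoOp_single h1 (k := n + 1) (g := fanoutMap) (c := 1) (.extra (.mk n))
      (f := Fin.snoc (α := fun _ => Fin (n + 1) × Fin 3) (fun j => (j.castSucc, 1))
        (Fin.last n, 0)) ?_ ?_ ?_
    · intro i j
      refine Fin.lastCases ?_ (fun i => ?_) i <;> refine Fin.lastCases ?_ (fun j => ?_) j <;> simp
    · intro x i
      refine Fin.lastCases ?_ (fun i => ?_) i <;> simp [F₁, fanoutMap]
    · rintro x ⟨i, b⟩ hi
      refine if_neg ?_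
      rintro ⟨hb, hl⟩
      dsimp only at hb hl
      obtain ⟨j, rfl⟩ := Fin.exists_castSucc_eq.2 hl
      exact hi j.castSucc (by simp [hb])
  have hF₂ : Par 𝒢 (monoOp F₂ 1) := by
    have h := Par.of_monoOp h1 (J := Fin n) (k := fun _ => 3)
      (fun _ => flipLast fun x : Bits 2 => decide (∀ i, x i = true)) (fun _ => 1)
      (fun _ => .toffoli 2) (fun j => ![(j.castSucc, (0 : Fin 3)), (j.castSucc, 1), (j.castSucc, 2)])
      ?_ F₂ ?_ ?_
    · simpa [Pi.one_def] using h
    · intro j i j' i' h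
      fin_cases i <;> fin_cases i' <;> simp_all
    · intro x j i
      fin_cases i <;>
        simp [F₂, flipLast, Fin.snoc, Fin.init, Fin.forall_fin_two, Fin.last]
      exact fun h => absurd (congrArg Fin.val h) j.isLt.ne
    · rintro x ⟨i, b⟩ hi
      refine if_neg ?_
      rintro ⟨hb, hl⟩
      dsimp only at hb hl
      obtain ⟨j, rfl⟩ := Fin.exists_castSucc_eq.2 hl
      exact hi j 2 (by simp [hb])
  have hC : Par 𝒢 (monoOp id fun x : Fin (n + 1) × Fin 3 → Bool =>
      ∏ p : Fin (n + 1) × Fin 3, if x p = true then (if p.2 = 2 then δ else 1) else 1) := by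
    refine Par.tens_phase fun p => ?_
    split_ifs
    · exact phase_mem_phaseGateSet hδ
    · exact phase_mem_phaseGateSet (one_pow q)
  have hinv₁ : ∀ x, F₁ (F₁ x) = x := by
    intro x
    ext p
    by_cases h : p.2 = 1 ∧ p.1 ≠ Fin.last n <;> simp [F₁, h]
  have hinv₂ : ∀ x, F₂ (F₂ x) = x := by
    intro x
    ext p
    by_cases h : p.2 = 2 ∧ p.1 ≠ Fin.last n <;> simp [F₂, h]
  have h := Impl.diag (o := 0) ((Circ.of_par hF₂).comp (Circ.of_par hF₁))
    ((Circ.of_par hF₁).comp (Circ.of_par hF₂)) hC fun x => by rw [hinv₂, hinv₁]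
  rw [phaseGate]
  convert h using 2
  ext x
  rw [Fintype.prod_prod_type, Fin.prod_univ_castSucc]
  have hlast : (∏ b : Fin 3, if F₂ (F₁ (slot 0 x)) (Fin.last n, b) = true then
      (if b = 2 then δ else 1) else 1) = 1 := by
    simp [Fin.prod_univ_three, F₁, F₂, slot]
  have hj : ∀ j : Fin n, (∏ b : Fin 3, if F₂ (F₁ (slot 0 x)) (j.castSucc, b) = true then
      (if b = 2 then δ else 1) else 1) =
      if x (Fin.last n) = true then δ ^ (x j.castSucc).toNat else 1 := by
    intro j
    simp only [Fin.prod_univ_three, F₁, F₂, slot]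
    cases x j.castSucc <;> cases x (Fin.last n) <;> simp
  simp only [hlast, hj, mul_one]
  split_ifs
  · rw [Finset.prod_pow_eq_pow_sum]
  · simp

theorem Par.single_phase {S : Set (Op 1)} {ℰ : GateSet} {ι : Type} [Fintype ι] [DecidableEq ι]
    (h1 : 1 ∈ S) {z : ℂ} (h : oneQubitOp (qubitPhase z) ∈ S) (t : ι) :
    Par (LayerGates S ℰ) (monoOp id fun x : ι → Bool => if x t = true then z else 1) := by
  have := Par.tens_phase (ι := ι) (S := S) (ℰ := ℰ) (z := fun i => if i = t then z else 1) fun i => by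
    split_ifs
    · exact h
    · rwa [qubitPhase_one, oneQubitOp_one]
  convert this using 2
  ext x
  rw [Finset.prod_eq_single t]
  · simp
  · intro i _ hi
    simp [hi]
  · simp

theorem update_xor_involutive {ι κ : Type} [DecidableEq ι] (c : (κ → Bool) → Bool) {f : κ → ι}
    {t : ι} (ht : ∀ j, f j ≠ t) :
    Function.Involutive fun x : ι → Bool => Function.update x t (xor (x t) (c (x ∘ f))) := by
  intro x
  have : Function.update x t (xor (x t) (c (x ∘ f))) ∘ f = x ∘ f :=
    funext fun j => Function.update_of_ne (ht j) _ _
  dsimp only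
  rw [this]
  simp

theorem monoOp_id_list_prod {ι K : Type} [Fintype ι] [DecidableEq ι] (g : K → (ι → Bool) → ℂ)
    (L : List K) : monoOp id (fun x => (L.map fun k => g k x).prod) =
      (L.map fun k => (monoOp id (g k) : LOp ι)).prod := by
  induction L with
  | nil => exact one_eq_monoOp.symm
  | cons k L ih =>
    rw [List.map_cons, List.prod_cons, ← ih, monoOp_mul]
    simp

theorem Circ.prod_diag {𝒢 : GateSet} {ι K : Type} [Fintype ι] [DecidableEq ι] [Fintype K] {d : ℕ}
    {g : K → (ι → Bool) → ℂ} (h : ∀ k, Circ 𝒢 d (monoOp id (g k))) :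
    Circ 𝒢 (Fintype.card K * d) (monoOp id fun x => ∏ k, g k x) := by
  have := Circ.list_prod (𝒢 := 𝒢) (d := d)
    (L := (Finset.univ : Finset K).toList.map fun k => monoOp id (g k)) (by
      intro M hM
      obtain ⟨k, _, rfl⟩ := List.mem_map.1 hM
      exact h k)
  rw [← monoOp_id_list_prod, List.length_map, Finset.length_toList] at this
  simp only [Finset.prod_map_toList] at this
  exact this

theorem Impl.prod_diag {𝒢 : GateSet} {ι β K : Type} [Fintype ι] [DecidableEq ι] [Fintype β]
    [DecidableEq β] [Fintype K] {o : β} {d : ℕ} {g : K → (ι → Bool) → ℂ}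
    (h : ∀ k, Impl 𝒢 o d (monoOp id (g k))) :
    Impl 𝒢 o (Fintype.card K * d) (monoOp id fun x => ∏ k, g k x) := by
  have := Impl.list_prod (𝒢 := 𝒢) (o := o) (d := d)
    (L := (Finset.univ : Finset K).toList.map fun k => monoOp id (g k)) (by
      intro M hM
      obtain ⟨k, _, rfl⟩ := List.mem_map.1 hM
      exact h k)
  rw [← monoOp_id_list_prod, List.length_map, Finset.length_toList] at this
  simp only [Finset.prod_map_toList] at this
  exact this

/-- Exactly one `k < q` passes the test, and for it `q - k ≡ s` modulo `q`. If `q` divides `s`, this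
is `k = 0`, with factor `δ ^ q = 1`. -/
theorem prod_phase_of_modEq {q : ℕ} (hq : 0 < q) {δ : ℂ} (hδ : δ ^ q = 1) (s : ℕ) :
    (∏ k : Fin q, if s + k ≡ 0 [MOD q] then δ ^ (q - k) else 1) = δ ^ s := by
  have hs : s % q < q := Nat.mod_lt _ hq
  have hdiv := Nat.div_add_mod s q
  have hpow : δ ^ s = δ ^ (s % q) := by
    conv_lhs => rw [← hdiv, pow_add, pow_mul, hδ, one_pow, one_mul]
  by_cases h0 : s % q = 0
  · rw [Finset.prod_eq_single (⟨0, hq⟩ : Fin q), if_pos, hpow, h0]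
    · simp [hδ]
    · simpa [Nat.ModEq] using h0
    · intro k _ hk
      refine if_neg fun h => hk ?_
      ext
      have hk' := (Nat.ModEq.add_right (k : ℕ) (Nat.mod_modEq s q)).trans h
      rw [h0, zero_add] at hk'
      simpa [Nat.ModEq, Nat.mod_eq_of_lt k.isLt] using hk'
    · simp
  · rw [Finset.prod_eq_single (⟨q - s % q, by omega⟩ : Fin q), if_pos, hpow]
    · congr 1
      dsimp only
      omega
    · refine (Nat.ModEq.add_right _ (Nat.mod_modEq s q)).symm.trans ?_
      dsimp only
      rw [Nat.add_sub_cancel' hs.le]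
      simp [Nat.ModEq]
    · intro k _ hk
      refine if_neg fun h => hk ?_
      ext
      have hk' := (Nat.ModEq.add_right (k : ℕ) (Nat.mod_modEq s q)).trans h
      have hk'' := (Nat.modEq_zero_iff_dvd.1 hk')
      obtain ⟨c, hc⟩ := hk''
      have hlt := k.isLt
      have hc1 : c = 1 := by
        have h1 : c < 2 := by
          by_contra! h2
          nlinarith
        have h3 : c ≠ 0 := by
          rintro rfl
          omega
        omega
      rw [hc1] at hc
      dsimp only
      omega
    · simp

/-- `MOD_q` yields the phase gates whose order divides `q`: the sum of the inputs modulo `q` is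
found by adding constants. -/
theorem mod_simulates_phase {q : ℕ} (hq : 0 < q) : Simulates (ModGates q) (PhaseGates q) := by
  -- The `q` tests run one after another. Each takes three layers to compute, one for the phase and
  -- three to uncompute.
  refine ⟨phaseGateSet q, Fin 3 ⊕ Fin q, inferInstance, inferInstance, Sum.inl 0, q * 7,
    phaseGateSet_finite hq, phaseGateSet_subset hq, one_mem_phaseGateSet q, ?_⟩
  rintro _ _ ⟨δ, hδ, n⟩
  set 𝒢 := LayerGates (phaseGateSet q) (ModGates q)
  have h1 : 𝒢 1 1 := .oneQubit (one_mem_phaseGateSet q)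
  have key : ∀ k : Fin q, Impl 𝒢 (Sum.inl 0 : Fin 3 ⊕ Fin q) 7
      (monoOp id fun x : Bits (n + 1) => if x (Fin.last n) = true then
        (if (∑ j : Fin n, (x j.castSucc).toNat) + k ≡ 0 [MOD q] then δ ^ (q - k) else 1)
        else 1) := by
    intro k
    let l := Fin.last n
    -- The inputs of the `MOD_q` gate: the data lines and `k` auxiliary lines flipped to `1`, which
    -- add `k` to the sum. The outcome goes to slot `inl 1`, its conjunction with `b` to slot `inl
    -- 2`.
    let f : Fin (n + k) → Fin (n + 1) × (Fin 3 ⊕ Fin q) :=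
      Fin.append (fun j => (j.castSucc, Sum.inl 0)) (fun i => (l, Sum.inr (Fin.castLE k.isLt.le i)))
    let f' : Fin 2 → Fin (n + 1) × (Fin 3 ⊕ Fin q) := ![(l, Sum.inl 0), (l, Sum.inl 1)]
    have hf : Function.Injective f := by
      intro i j
      refine Fin.addCases (fun i => ?_) (fun i => ?_) i <;>
        refine Fin.addCases (fun j => ?_) (fun j => ?_) j <;> simp [f]
    have hf' : Function.Injective f' := by
      intro i j
      fin_cases i <;> fin_cases j <;> simp [f']
    have ht : ∀ j, f j ≠ (l, Sum.inl 1) := by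
      intro j
      refine Fin.addCases (fun j => ?_) (fun j => ?_) j <;> simp [f]
    have ht' : ∀ j, f' j ≠ (l, Sum.inl 2) := by
      intro j
      fin_cases j <;> simp [f']
    have hX := Par.tens_not (ℰ := ModGates q) (one_mem_phaseGateSet q) (not_mem_phaseGateSet q)
      fun p : Fin (n + 1) × (Fin 3 ⊕ Fin q) => p.2.isRight = true
    have hM := Par.flip (𝒢 := 𝒢) h1 (.extra (.mk (n + k))) hf ht
    have hT := Par.flip (𝒢 := 𝒢) h1 (.toffoli 2) hf' ht'
    have hP := Par.single_phase (ℰ := ModGates q) (one_mem_phaseGateSet q)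
      (phase_mem_phaseGateSet (q := q) (δ := δ ^ (q - k)) (by
        rw [← pow_mul, mul_comm, pow_mul, hδ, one_pow])) (l, (Sum.inl 2 : Fin 3 ⊕ Fin q))
    have hX' : Function.Involutive fun (x : Fin (n + 1) × (Fin 3 ⊕ Fin q) → Bool)
        (p : Fin (n + 1) × (Fin 3 ⊕ Fin q)) => if p.2.isRight = true then !x p else x p := by
      intro x
      ext p
      by_cases h : p.2.isRight = true <;> simp [h]
    have hM' := update_xor_involutive
      (fun x : Bits (n + k) => decide ((∑ i, (x i).toNat) ≡ 0 [MOD q])) ht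
    have hT' := update_xor_involutive (fun x : Bits 2 => decide (∀ i, x i = true)) ht'
    have h := Impl.diag (o := Sum.inl 0)
      (((Circ.of_par hT).comp (Circ.of_par hM)).comp (Circ.of_par hX))
      ((Circ.of_par hX).comp ((Circ.of_par hM).comp (Circ.of_par hT))) hP fun x => by
        have e1 := hT' ((fun x => Function.update x (l, Sum.inl 1) (xor (x (l, Sum.inl 1))
          (decide ((∑ i, ((x ∘ f) i).toNat) ≡ 0 [MOD q]))))
          (fun p => if p.2.isRight = true then !x p else x p))
        have e2 := hM' (fun p => if p.2.isRight = true then !x p else x p)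
        have e3 := hX' x
        dsimp only at e1 e2 e3 ⊢
        rw [e1, e2, e3]
    convert h using 2
    ext x
    have hsum : (∑ i, (((fun p => if p.2.isRight = true then
        !(slot (Sum.inl 0 : Fin 3 ⊕ Fin q) x p) else slot (Sum.inl 0) x p) ∘ f) i).toNat) =
        (∑ j : Fin n, (x j.castSucc).toNat) + k := by
      rw [Fin.sum_univ_add]
      simp [f, slot]
    simp only [Function.update_self, hsum]
    simp only [f', Function.comp_apply, Fin.forall_fin_two, Matrix.cons_val_zero,
      Matrix.cons_val_one, Function.update_self]
    rw [Function.update_of_ne (by simp), Function.update_of_ne (by simp)]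
    simp only [slot]
    by_cases hx : x l = true <;> by_cases hm : (∑ j : Fin n, (x j.castSucc).toNat) + k ≡ 0 [MOD q]
      <;> simp [hx, hm, l]
  have h := Impl.prod_diag key
  rw [Fintype.card_fin] at h
  rw [phaseGate]
  convert h using 2
  ext x
  split_ifs
  · exact (prod_phase_of_modEq hq hδ _).symm
  · simp

/-! ### Controlled tensor products, and fan-out from phase gates -/

/-- A tensor product of one-qubit matrices, controlled by a function of the basis state. -/
def ctens {ι C : Type} [Fintype ι] (c : (ι → Bool) → C) (G : C → ι → Matrix Bool Bool ℂ) :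
    LOp ι :=
  Matrix.of fun y x => ∏ i, G (c x) i (y i) (x i)

theorem ctens_apply {ι C : Type} [Fintype ι] (c : (ι → Bool) → C)
    (G : C → ι → Matrix Bool Bool ℂ) (y x : ι → Bool) :
    ctens c G y x = ∏ i, G (c x) i (y i) (x i) := rfl

theorem ctens_const {ι C : Type} [Fintype ι] (c : (ι → Bool) → C) (U : ι → Matrix Bool Bool ℂ) :
    ctens c (fun _ => U) = tens U := rfl

theorem ctens_monoOp {ι C : Type} [Fintype ι] (c : (ι → Bool) → C) (f : C → ι → Bool → Bool)
    (d : C → ι → Bool → ℂ) :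
    ctens c (fun a i => monoOp (f a i) (d a i)) =
      monoOp (fun x i => f (c x) i (x i)) fun x => ∏ i, d (c x) i (x i) := by
  ext y x
  exact congrFun (congrFun (tens_monoOp (f (c x)) (d (c x))) y) x

/-- The controls are unaffected when the right factor is the identity on the control lines. -/
theorem ctens_mul {ι C : Type} [Fintype ι] [DecidableEq ι] {c : (ι → Bool) → C}
    {G H : C → ι → Matrix Bool Bool ℂ} {K : Set ι}
    (hc : ∀ y x, (∀ i ∈ K, y i = x i) → c y = c x) (hH : ∀ a, ∀ i ∈ K, H a i = 1) :
    ctens c G * ctens c H = ctens c fun a i => G a i * H a i := by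
  ext y x
  have h := congrFun (congrFun (tens_mul (G (c x)) (H (c x))) y) x
  refine Eq.trans ?_ h
  rw [Matrix.mul_apply, Matrix.mul_apply]
  refine Finset.sum_congr rfl fun w _ => ?_
  by_cases h0 : ctens c H w x = 0
  · rw [h0, mul_zero]
    exact (mul_eq_zero_of_right _ h0).symm
  · have hw : c w = c x := hc w x fun i hi => by
      have := Finset.prod_ne_zero_iff.1 h0 i (Finset.mem_univ i)
      rw [hH _ i hi, Matrix.one_apply] at this
      by_contra hne
      exact this (if_neg hne)
    rw [ctens_apply, hw]
    rfl

theorem ctens_apply_of_eq_one {ι C : Type} [Fintype ι] {c : (ι → Bool) → C}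
    {G : C → ι → Matrix Bool Bool ℂ} (y : ι → Bool) {x : ι → Bool} (h : ∀ i, G (c x) i = 1) :
    ctens c G y x = if y = x then 1 else 0 := by
  rw [ctens_apply, funext h]
  have := congrFun (congrFun (tens_monoOp (fun _ : ι => (id : Bool → Bool)) fun _ => 1) y) x
  simp only [← one_eq_monoOp] at this
  refine this.trans ?_
  simp [monoOp_apply]

theorem ctens_one {ι C : Type} [Fintype ι] (c : (ι → Bool) → C) :
    ctens c (fun _ _ => 1) = (1 : LOp ι) := by
  ext y x
  rw [ctens_apply_of_eq_one y fun _ => rfl, Matrix.one_apply]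

theorem I_smul_qubitNot : Complex.I • qubitNot = monoOp not fun _ => Complex.I := by
  rw [qubitNot_eq_monoOp]
  ext y x
  simp [monoOp_apply]

theorem mul_star_mul_star {A B : Matrix Bool Bool ℂ} (hA : A ∈ Matrix.unitaryGroup Bool ℂ)
    (hB : B ∈ Matrix.unitaryGroup Bool ℂ) : A * B * (star B * star A) = 1 := by
  rw [Matrix.mul_assoc, ← Matrix.mul_assoc B, Matrix.mem_unitaryGroup_iff.1 hB, Matrix.one_mul,
    Matrix.mem_unitaryGroup_iff.1 hA]

/-- The reading of the phase gate with its last line as control: one gate acts on all the other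
lines at once. -/
theorem phaseGate_eq_ctens (δ : ℂ) (n : ℕ) :
    phaseGate δ n = ctens (fun x => x (Fin.last n)) fun b i =>
      if i = Fin.last n then 1 else qubitPhase (if b = true then δ else 1) := by
  have h : ∀ (b : Bool) (i : Fin (n + 1)),
      (if i = Fin.last n then 1 else qubitPhase (if b = true then δ else 1)) =
      monoOp id fun y => if i = Fin.last n then 1 else
        if y = true then (if b = true then δ else 1) else 1 := by
    intro b i
    split_ifs
    · exact one_eq_monoOp
    · exact qubitPhase_eq_monoOp _
    · exact qubitPhase_eq_monoOp _
  simp only [h]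
  rw [ctens_monoOp, phaseGate]
  congr 1
  ext x
  rw [Fin.prod_univ_castSucc]
  simp only [Fin.castSucc_ne_last, if_true, if_false, mul_one]
  cases x (Fin.last n)
  · simp
  · simp only [if_true]
    rw [← Finset.prod_pow_eq_pow_sum]
    refine Finset.prod_congr rfl fun j _ => ?_
    cases x j.castSucc <;> simp

/-- Phase gates yield fan-out: they apply `i X` to each target when `b = 1`. -/
theorem phase_simulates_fanout {q : ℕ} (hq : 2 ≤ q) : Simulates (PhaseGates q) FanoutGates := by
  obtain ⟨δ, hδ, hre⟩ := exists_pow_eq_one_re_pow_nonpos (t := q) (k := 1) one_pos (by omega)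
  rw [pow_one] at hre
  have hδ' := mul_star_eq_one_of_pow_eq_one (by omega) hδ
  obtain ⟨A, hA, B, hB, hAB⟩ := exists_commutator_eq_qubitNot hδ' hre
  let T : Set (Matrix Bool Bool ℂ) :=
    {1, A, B, star B * star A} ∪ Set.range fun k : Fin 4 => qubitPhase ((-Complex.I) ^ (k : ℕ))
  have hTfin : T.Finite := (Set.toFinite _).union (Set.finite_range _)
  have hTu : T ⊆ Matrix.unitaryGroup Bool ℂ := by
    rintro U ((rfl | rfl | rfl | rfl) | ⟨k, rfl⟩)
    · exact one_mem (Matrix.unitaryGroup Bool ℂ)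
    · exact hA
    · exact hB
    · exact mul_mem (Unitary.star_mem hB) (Unitary.star_mem hA)
    · exact qubitPhase_mem (by rw [star_pow, ← mul_pow]; simp)
  -- Powers of `-i` have period `4`, so the correction for every arity comes from one finite set of
  -- gates.
  have hTn : ∀ n : ℕ, qubitPhase ((-Complex.I) ^ n) ∈ T := by
    intro n
    refine Or.inr ⟨⟨n % 4, Nat.mod_lt _ (by norm_num)⟩, ?_⟩
    dsimp only
    congr 1
    conv_rhs => rw [← Nat.div_add_mod n 4, pow_add, pow_mul]
    have : (-Complex.I) ^ 4 = 1 := by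
      rw [neg_pow, Complex.I_pow_four]
      norm_num
    rw [this, one_pow, one_mul]
  let S := oneQubitOp '' T
  have h1S : 1 ∈ S := ⟨1, Or.inl (Or.inl rfl), oneQubitOp_one⟩
  refine ⟨S, Unit, inferInstance, inferInstance, (), 5, hTfin.image _, ?_, h1S, ?_⟩
  · rintro _ ⟨U, hU, rfl⟩
    exact oneQubitOp_mem (hTu hU)
  rintro _ _ ⟨n⟩
  set 𝒢 := LayerGates S (PhaseGates q)
  have h1 : 𝒢 1 1 := .oneQubit h1S
  have layer : ∀ U ∈ T, ∀ V ∈ T,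
      Impl 𝒢 () 1 (tens fun i : Fin (n + 1) => if i = Fin.last n then U else V) := by
    intro U hU V hV
    refine Impl.of_par h1 _ (Par.tens fun i => ?_)
    split_ifs
    · exact ⟨U, hU, rfl⟩
    · exact ⟨V, hV, rfl⟩
  have phase : ∀ z : ℂ, z ^ q = 1 → Impl 𝒢 () 1 (phaseGate z n) := fun z hz =>
    Impl.of_par h1 _ (Par.gate (.extra (.mk z hz n)))
  -- For `b = 1` the `n` targets contribute the factor `i ^ n`, which the gate on the control line
  -- cancels. For `b = 0` the word on each target collapses to `1`.
  have h := ((((layer _ (hTn n) A (by simp [T])).mul (phase δ hδ)).mul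
    (layer 1 (by simp [T]) B (by simp [T]))).mul (phase (star δ) (by rw [← star_pow, hδ, star_one]))).mul
    (layer 1 (by simp [T]) (star B * star A) (by simp [T]))
  convert h using 1
  let c : Bits (n + 1) → Bool := fun x => x (Fin.last n)
  have hc : ∀ y x : Bits (n + 1), (∀ i ∈ ({Fin.last n} : Set (Fin (n + 1))), y i = x i) →
      c y = c x := fun y x h => h _ rfl
  rw [← ctens_const c, ← ctens_const c, ← ctens_const c, phaseGate_eq_ctens, phaseGate_eq_ctens,
    ctens_mul hc, ctens_mul hc, ctens_mul hc, ctens_mul hc]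
  rotate_left
  iterate 4
    rintro a i rfl
    exact if_pos rfl
  have hG : ∀ (b : Bool) (i : Fin (n + 1)),
      ((((if i = Fin.last n then qubitPhase ((-Complex.I) ^ n) else A) *
      (if i = Fin.last n then 1 else qubitPhase (if b = true then δ else 1))) *
      (if i = Fin.last n then 1 else B)) *
      (if i = Fin.last n then 1 else qubitPhase (if b = true then star δ else 1))) *
      (if i = Fin.last n then 1 else star B * star A) =
      monoOp (fun y => if i = Fin.last n then y else xor y b) fun y =>
        if i = Fin.last n then (if y = true then (-Complex.I) ^ n else 1) else
          if b = true then Complex.I else 1 := by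
    intro b i
    by_cases hi : i = Fin.last n
    · simp only [hi, if_true, mul_one]
      exact qubitPhase_eq_monoOp _
    · simp only [hi, if_false]
      cases b
      · simp only [Bool.false_eq_true, if_false, qubitPhase_one, mul_one, Bool.xor_false]
        rw [mul_star_mul_star hA hB]
        exact one_eq_monoOp
      · simp only [if_true, Bool.xor_true]
        rw [hAB, I_smul_qubitNot]
  simp only [hG]
  rw [ctens_monoOp, fanoutGate, basisOp_eq_monoOp]
  congr 1
  · ext x i
    refine Fin.lastCases ?_ (fun i => ?_) i <;> simp [fanoutMap, c]
  · ext x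
    rw [Fin.prod_univ_castSucc]
    simp only [Fin.castSucc_ne_last, if_true, if_false, c, Pi.one_apply]
    by_cases hx : x (Fin.last n) = true
    · simp [hx, ← mul_pow]
    · simp [hx]

/-! ### `MOD_t` from phase gates -/

/-- The value `X k` on the `k`-th auxiliary line of the last line, and `d` on all other lines. -/
def lastAux {n t : ℕ} {γ : Type} (d : γ) (X : Fin t → γ) (p : Fin (n + 1) × Option (Fin t)) : γ :=
  if p.1 = Fin.last n then p.2.elim d X else d

theorem lastAux_last {n t : ℕ} {γ : Type} (d : γ) (X : Fin t → γ) (k : Fin t) :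
    lastAux d X (Fin.last n, some k) = X k := if_pos rfl

theorem lastAux_none {n t : ℕ} {γ : Type} (d : γ) (X : Fin t → γ) (i : Fin (n + 1)) :
    lastAux d X (i, none) = d := by simp [lastAux]

theorem lastAux_map {n t : ℕ} {γ γ' : Type} (g : γ → γ') (d : γ) (X : Fin t → γ)
    (p : Fin (n + 1) × Option (Fin t)) : g (lastAux d X p) = lastAux (g d) (fun k => g (X k)) p := by
  obtain ⟨i, _ | k⟩ := p
  · simp [lastAux]
  · simp only [lastAux, Option.elim]
    split_ifs <;> rfl

theorem lastAux_mul {n t : ℕ} {γ : Type} [Monoid γ] (X Y : Fin t → γ)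
    (p : Fin (n + 1) × Option (Fin t)) :
    lastAux 1 X p * lastAux 1 Y p = lastAux 1 (fun k => X k * Y k) p := by
  obtain ⟨i, _ | k⟩ := p
  · simp [lastAux]
  · simp only [lastAux, Option.elim]
    split_ifs <;> simp

theorem lastAux_one {n t : ℕ} {γ : Type} (d : γ) (p : Fin (n + 1) × Option (Fin t)) :
    lastAux d (fun _ => d) p = d := by
  obtain ⟨i, _ | k⟩ := p <;> simp [lastAux]

/-- The number of data lines, other than the last one, that carry `1`. -/
def dataSum {n t : ℕ} (x : Fin (n + 1) × Option (Fin t) → Bool) : ℕ :=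
  ∑ j : Fin n, (x (j.castSucc, none)).toNat

/-- The opposite reading of the phase gate: the data lines control a phase on an auxiliary line. The
`t` gates share the data lines, so they run one after another, in depth `t`. -/
theorem Circ.ctens_phase {S : Set (Op 1)} {t n : ℕ} (h1 : 1 ∈ S) {z : Fin t → ℂ}
    (hz : ∀ k, z k ^ t = 1) :
    Circ (LayerGates S (PhaseGates t)) t
      (ctens (dataSum (n := n)) fun a => lastAux 1 fun k => qubitPhase (z k ^ a)) := by
  have hk : ∀ k : Fin t, Circ (LayerGates S (PhaseGates t)) 1
      (monoOp id fun x : Fin (n + 1) × Option (Fin t) → Bool =>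
        if x (Fin.last n, some k) = true then z k ^ dataSum x else 1) := by
    intro k
    have h := Par.of_monoOp_single (𝒢 := LayerGates S (PhaseGates t)) (.oneQubit h1)
      (LayerGates.extra (PhaseGates.mk (z k) (hz k) n))
      (f := Fin.snoc (α := fun _ => Fin (n + 1) × Option (Fin t)) (fun j => (j.castSucc, none))
        (Fin.last n, some k)) ?_ (F := id) (fun _ _ => rfl) (fun _ _ _ => rfl)
    · simp only [Function.comp_apply, Fin.snoc_last, Fin.snoc_castSucc] at h
      exact Circ.of_par h
    · intro i j
      refine Fin.lastCases ?_ (fun i => ?_) i <;> refine Fin.lastCases ?_ (fun j => ?_) j <;> simp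
  have h := Circ.prod_diag hk
  rw [Fintype.card_fin, mul_one] at h
  have hG : ∀ (a : ℕ) (p : Fin (n + 1) × Option (Fin t)),
      lastAux 1 (fun k => qubitPhase (z k ^ a)) p =
      monoOp id fun b => if b = true then lastAux 1 (fun k => z k ^ a) p else 1 := by
    intro a p
    rw [← qubitPhase_eq_monoOp, lastAux_map qubitPhase, qubitPhase_one]
  have hG' : (fun (a : ℕ) => lastAux (n := n) 1 fun k => qubitPhase (z k ^ a)) = fun a p =>
      monoOp id fun b => if b = true then lastAux 1 (fun k => z k ^ a) p else 1 :=
    funext fun a => funext fun p => hG a p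
  rw [hG', ctens_monoOp]
  convert h using 2
  · rfl
  ext x
  rw [Fintype.prod_prod_type, Fin.prod_univ_castSucc]
  simp only [Fintype.prod_option, lastAux_none, lastAux_last]
  simp [lastAux]

/-- Flip the last data line iff its auxiliary lines all carry `0`. -/
def flipNor {n t : ℕ} (x : Fin (n + 1) × Option (Fin t) → Bool) :
    Fin (n + 1) × Option (Fin t) → Bool :=
  Function.update x (Fin.last n, none)
    (xor (x (Fin.last n, none)) (decide (∀ k, x (Fin.last n, some k) = false)))

theorem Circ.flipNor {S : Set (Op 1)} {ℰ : GateSet} {t n : ℕ} (h1 : 1 ∈ S)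
    (h : oneQubitOp qubitNot ∈ S) :
    Circ (LayerGates S ℰ) 3 (monoOp (flipNor (n := n) (t := t)) 1) := by
  have hX := Circ.of_par (Par.tens_not (ℰ := ℰ) h1 h
    fun p : Fin (n + 1) × Option (Fin t) => p.2.isSome = true)
  have hT := Circ.of_par (Par.flip (𝒢 := LayerGates S ℰ) (.oneQubit h1) (.toffoli t)
    (f := fun k => (Fin.last n, some k)) (t := ((Fin.last n, none) : Fin (n + 1) × Option (Fin t)))
    (fun i j hij => by simpa using hij) (fun j => by simp))
  have hN := hX.comp (hT.comp hX)
  convert hN using 2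
  ext x ⟨i, b⟩
  rcases b with _ | k
  · by_cases hi : i = Fin.last n
    · subst hi
      simp [_root_.flipNor]
    · have hne : ((i, none) : Fin (n + 1) × Option (Fin t)) ≠ (Fin.last n, none) := by simpa using hi
      rw [_root_.flipNor, Function.update_of_ne hne]
      simp [hi]
  · rw [_root_.flipNor, Function.update_of_ne (by simp)]
    simp

/-- Phase gates yield `MOD_t`: the `k`-th auxiliary line is left at `0` if the sum of the inputs is
`0` modulo `t`, and is set to `1` if the sum is `k ≠ 0` modulo `t`. -/
theorem phase_simulates_mod {t : ℕ} (ht : 0 < t) : Simulates (PhaseGates t) (ModGates t) := by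
  have hex : ∀ k : Fin t, ∃ (δ : ℂ) (A B : Matrix Bool Bool ℂ), δ ^ t = 1 ∧
      A ∈ Matrix.unitaryGroup Bool ℂ ∧ B ∈ Matrix.unitaryGroup Bool ℂ ∧ ((k : ℕ) ≠ 0 →
        A * qubitPhase (δ ^ (k : ℕ)) * B * qubitPhase (star δ ^ (k : ℕ)) * (star B * star A) =
          Complex.I • qubitNot) := by
    intro k
    by_cases hk : (k : ℕ) = 0
    -- Residue `0` needs no marker; trivial gates leave its auxiliary line at `0`.
    · exact ⟨1, 1, 1, one_pow t, one_mem (Matrix.unitaryGroup Bool ℂ),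
        one_mem (Matrix.unitaryGroup Bool ℂ), fun h => absurd hk h⟩
    · obtain ⟨δ, hδ, hre⟩ := exists_pow_eq_one_re_pow_nonpos (Nat.pos_of_ne_zero hk) k.isLt
      obtain ⟨A, hA, B, hB, hAB⟩ := exists_commutator_eq_qubitNot (δ := δ ^ (k : ℕ)) (by
        rw [star_pow, ← mul_pow, mul_star_eq_one_of_pow_eq_one ht.ne' hδ, one_pow]) hre
      exact ⟨δ, A, B, hδ, hA, hB, fun _ => by rw [← star_pow]; exact hAB⟩
  choose δ A B hδ hA hB hAB using hex
  have hδ' : ∀ k, star (δ k) ^ t = 1 := fun k => by rw [← star_pow, hδ, star_one]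
  let T : Set (Matrix Bool Bool ℂ) := {1, qubitNot} ∪ ((Set.range A ∪ Set.range B) ∪
    (Set.range (fun k => star (B k) * star (A k)) ∪
    (Set.range (fun k => A k * B k) ∪ (Set.range (fun k => star (B k)) ∪
    Set.range (fun k => star (A k))))))
  have hTfin : T.Finite := Set.toFinite _
  have hTu : T ⊆ Matrix.unitaryGroup Bool ℂ := by
    rintro U ((rfl | rfl) | (⟨k, rfl⟩ | ⟨k, rfl⟩) | ⟨k, rfl⟩ | ⟨k, rfl⟩ | ⟨k, rfl⟩ | ⟨k, rfl⟩)
    · exact one_mem (Matrix.unitaryGroup Bool ℂ)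
    · exact qubitNot_mem
    · exact hA k
    · exact hB k
    · exact mul_mem (Unitary.star_mem (hB k)) (Unitary.star_mem (hA k))
    · exact mul_mem (hA k) (hB k)
    · exact Unitary.star_mem (hB k)
    · exact Unitary.star_mem (hA k)
  let S := oneQubitOp '' T
  have h1S : 1 ∈ S := ⟨1, Or.inl (Or.inl rfl), oneQubitOp_one⟩
  have hXS : oneQubitOp qubitNot ∈ S := ⟨_, Or.inl (Or.inr rfl), rfl⟩
  refine ⟨S, Option (Fin t), inferInstance, inferInstance, none,
    (1 + t + 1 + t + 1) + (3 + (1 + t + 1 + t + 1)), hTfin.image _, ?_, h1S, ?_⟩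
  · rintro _ ⟨U, hU, rfl⟩
    exact oneQubitOp_mem (hTu hU)
  rintro _ _ ⟨n⟩
  let c := dataSum (n := n) (t := t)
  let K : Set (Fin (n + 1) × Option (Fin t)) := {p | p.2 = none}
  have hc : ∀ y x, (∀ p ∈ K, y p = x p) → c y = c x := fun y x h =>
    Finset.sum_congr rfl fun j _ => by rw [h (j.castSucc, none) rfl]
  have hK : ∀ (X : ℕ → Fin t → Matrix Bool Bool ℂ) (a : ℕ), ∀ p ∈ K, lastAux 1 (X a) p = 1 := by
    rintro X a ⟨i, b⟩ (rfl : b = none)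
    exact lastAux_none _ _ _
  have layer : ∀ X : Fin t → Matrix Bool Bool ℂ, (∀ k, X k ∈ T) →
      Circ (LayerGates S (PhaseGates t)) 1 (ctens c fun _ => lastAux 1 X) := by
    intro X hX
    refine Circ.of_par (Par.tens fun p => ?_)
    rw [lastAux_map oneQubitOp, lastAux]
    rcases p with ⟨i, _ | k⟩
    · simpa [oneQubitOp_one] using h1S
    · dsimp only [Option.elim]
      split_ifs
      · exact ⟨X k, hX k, rfl⟩
      · rwa [oneQubitOp_one]
  have hmul : ∀ X Y : ℕ → Fin t → Matrix Bool Bool ℂ,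
      ctens c (fun a => lastAux 1 (X a)) * ctens c (fun a => lastAux 1 (Y a)) =
      ctens c fun a => lastAux 1 fun k => X a k * Y a k := by
    intro X Y
    rw [ctens_mul hc (hK Y)]
    congr 1
    ext a p : 2
    exact lastAux_mul _ _ _
  let W : ℕ → Fin t → Matrix Bool Bool ℂ := fun a k =>
    A k * qubitPhase (δ k ^ a) * B k * qubitPhase (star (δ k) ^ a) * (star (B k) * star (A k))
  -- The adjoint of `W`. Taking adjoints reverses the two phases and conjugates them, so `δ` again
  -- stands before `star δ`.
  let W' : ℕ → Fin t → Matrix Bool Bool ℂ := fun a k =>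
    A k * B k * qubitPhase (δ k ^ a) * star (B k) * qubitPhase (star (δ k) ^ a) * star (A k)
  have hW : Circ (LayerGates S (PhaseGates t)) (1 + t + 1 + t + 1)
      (ctens c fun a => lastAux 1 (W a)) := by
    have := ((((layer A (by simp [T])).mul (Circ.ctens_phase h1S hδ)).mul
      (layer B (by simp [T]))).mul (Circ.ctens_phase h1S hδ')).mul
      (layer (fun k => star (B k) * star (A k)) (by simp [T]))
    rwa [hmul, hmul, hmul, hmul] at this
  have hW' : Circ (LayerGates S (PhaseGates t)) (1 + t + 1 + t + 1)
      (ctens c fun a => lastAux 1 (W' a)) := by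
    have := ((((layer (fun k => A k * B k) (by simp [T])).mul (Circ.ctens_phase h1S hδ)).mul
      (layer (fun k => star (B k)) (by simp [T]))).mul (Circ.ctens_phase h1S hδ')).mul
      (layer (fun k => star (A k)) (by simp [T]))
    rwa [hmul, hmul, hmul, hmul] at this
  have hWW : ctens c (fun a => lastAux 1 (W' a)) * ctens c (fun a => lastAux 1 (W a)) =
      (1 : LOp (Fin (n + 1) × Option (Fin t))) := by
    rw [hmul, ← ctens_one c]
    congr 1
    ext a p : 2
    refine Eq.trans ?_ (lastAux_one 1 p)
    congr 1
    ext k : 1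
    have hs : W' a k = star (W a k) := by
      simp only [W, W', star_mul, star_star, star_qubitPhase, star_pow, Matrix.mul_assoc]
    have hu : W a k ∈ Matrix.unitaryGroup Bool ℂ := by
      have hp : ∀ z : ℂ, z ^ t = 1 → qubitPhase (z ^ a) ∈ Matrix.unitaryGroup Bool ℂ := fun z hz =>
        qubitPhase_mem (mul_star_eq_one_of_pow_eq_one ht.ne' (by
          rw [← pow_mul, mul_comm, pow_mul, hz, one_pow]))
      exact mul_mem (mul_mem (mul_mem (mul_mem (hA k) (hp _ (hδ k))) (hB k)) (hp _ (hδ' k)))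
        (mul_mem (Unitary.star_mem (hB k)) (Unitary.star_mem (hA k)))
    rw [hs]
    exact Matrix.mem_unitaryGroup_iff'.1 hu
  refine ⟨_, hW'.mul ((Circ.flipNor h1S hXS).mul hW), ?_⟩
  ext w x
  have hcx : c (slot none x) = ∑ j : Fin n, (x j.castSucc).toNat := by
    simp [c, dataSum, slot]
  have hR : (adjoin (Fin (n + 1)) (none : Option (Fin t)) * modGate t n) w x =
      if w = slot none (flipLast (fun x => decide ((∑ i, (x i).toNat) ≡ 0 [MOD t])) x)
        then 1 else 0 := by
    rw [adjoin, modGate, basisOp_eq_monoOp, monoOp_mul, monoOp_apply]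
    simp
  have hcw : (∑ i, (Fin.init (α := fun _ => Bool) x i).toNat) = c (slot none x) := by
    rw [hcx]
    rfl
  rw [mul_adjoin_apply, hR, flipLast, hcw]
  -- If the sum is `0` modulo `t`, all the phases are `1`, every word collapses to the identity, and
  -- only the flip remains.
  by_cases hm : c (slot none x) ≡ 0 [MOD t]
  · have hone : ∀ p, lastAux (n := n) 1 (W (c (slot none x))) p = 1 := by
      intro p
      obtain ⟨d, hd⟩ := Nat.modEq_zero_iff_dvd.1 hm
      refine Eq.trans ?_ (lastAux_one 1 p)
      congr 1
      ext k : 1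
      simp only [W]
      rw [hd, pow_mul, pow_mul, hδ, hδ', one_pow, qubitPhase_one, mul_one, mul_one,
        mul_star_mul_star (hA k) (hB k)]
    have hone' : ∀ p, lastAux (n := n) 1 (W' (c (slot none x))) p = 1 := by
      intro p
      obtain ⟨d, hd⟩ := Nat.modEq_zero_iff_dvd.1 hm
      refine Eq.trans ?_ (lastAux_one 1 p)
      congr 1
      ext k : 1
      simp only [W']
      rw [hd, pow_mul, pow_mul, hδ, hδ', one_pow, qubitPhase_one, mul_one, mul_one,
        Matrix.mul_assoc _ (star (B k)), mul_star_mul_star (hA k) (hB k)]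
    have hflip : flipNor (slot none x) = slot (none : Option (Fin t))
        (Fin.snoc (α := fun _ => Bool) (Fin.init x) (xor (x (Fin.last n)) true)) := by
      ext ⟨i, _ | k⟩
      · rw [slot_self, flipNor]
        refine Fin.lastCases ?_ (fun i => ?_) i
        · simp [slot]
        · rw [Function.update_of_ne (by simp), slot_self]
          simp [Fin.init]
      · rw [slot_ne (by simp), flipNor, Function.update_of_ne (by simp), slot_ne (by simp)]
    have hcf : c (flipNor (slot none x)) = c (slot none x) := by
      simp only [c, dataSum, flipNor]
      refine Finset.sum_congr rfl fun j _ => ?_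
      rw [Function.update_of_ne (by simp)]
    have hcol : ∀ v, ctens c (fun a => lastAux 1 (W a)) v (slot none x) =
        if v = slot none x then 1 else 0 := fun v => ctens_apply_of_eq_one v hone
    have hcol' : ∀ v, ctens c (fun a => lastAux 1 (W' a)) v (flipNor (slot none x)) =
        if v = flipNor (slot none x) then 1 else 0 := fun v =>
      ctens_apply_of_eq_one v (by rw [hcf]; exact hone')
    rw [← Matrix.mul_assoc, Matrix.mul_apply]
    simp only [hcol, mul_ite, mul_one, mul_zero, Finset.sum_ite_eq',
      Finset.mem_univ, if_true]
    rw [Matrix.mul_apply]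
    simp only [monoOp_apply, Pi.one_apply, mul_ite, mul_one, mul_zero, Finset.sum_ite_eq',
      Finset.mem_univ, if_true]
    rw [hcol', hflip]
    simp [hm]
  -- The `k`-th auxiliary line becomes `i |1⟩`. The others may be in superposition, but the NOR is
  -- false on the whole support, so the flip does nothing and `W'` undoes `W`.
  · let k : Fin t := ⟨c (slot none x) % t, Nat.mod_lt _ ht⟩
    have hk : (k : ℕ) ≠ 0 := fun h => hm (by simpa [Nat.ModEq, k] using h)
    have hpow : ∀ z : ℂ, z ^ t = 1 → z ^ c (slot none x) = z ^ (k : ℕ) := by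
      intro z hz
      conv_lhs => rw [← Nat.div_add_mod (c (slot none x)) t, pow_add, pow_mul, hz, one_pow, one_mul]
    have hWk : W (c (slot none x)) k = Complex.I • qubitNot := by
      simp only [W]
      rw [hpow _ (hδ k), hpow _ (hδ' k), hAB k hk]
    have hsupp : ∀ s, ctens c (fun a => lastAux 1 (W a)) s (slot none x) ≠ 0 →
        flipNor s = s := by
      intro s hs
      have h := Finset.prod_ne_zero_iff.1 hs (Fin.last n, some k) (Finset.mem_univ _)
      dsimp only at h
      rw [lastAux_last, hWk, I_smul_qubitNot, slot_ne (by simp), monoOp_apply] at h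
      have hsk : s (Fin.last n, some k) = true := by
        by_contra hne
        exact h (if_neg hne)
      have : ¬ ∀ k, s (Fin.last n, some k) = false := fun h => by
        rw [h k] at hsk
        exact absurd hsk (by simp)
      rw [flipNor, decide_eq_false this, Bool.xor_false, Function.update_eq_self]
    have hNW : ∀ v, ((monoOp flipNor 1 : LOp (Fin (n + 1) × Option (Fin t))) *
        ctens c fun a => lastAux 1 (W a)) v (slot none x) =
        ctens c (fun a => lastAux 1 (W a)) v (slot none x) := by
      intro v
      rw [Matrix.mul_apply]
      have hterm : ∀ s, (monoOp flipNor 1 : LOp (Fin (n + 1) × Option (Fin t))) v s *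
          ctens c (fun a => lastAux 1 (W a)) s (slot none x) =
          if v = s then ctens c (fun a => lastAux 1 (W a)) s (slot none x) else 0 := by
        intro s
        by_cases h0 : ctens c (fun a => lastAux 1 (W a)) s (slot none x) = 0
        · simp [h0]
        · rw [monoOp_apply, hsupp s h0]
          simp
      simp only [hterm, Finset.sum_ite_eq, Finset.mem_univ, if_true]
    rw [Matrix.mul_apply]
    simp only [hNW]
    rw [← Matrix.mul_apply, hWW, Matrix.one_apply]
    simp [hm]

/-! ### Reductions between the classes -/

theorem fanout_simulates_mod {t : ℕ} (ht : 0 < t) : Simulates FanoutGates (ModGates t) :=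
  (fanout_simulates_phase ht).trans (phase_simulates_mod ht)

theorem mod_simulates_fanout {q : ℕ} (hq : 2 ≤ q) : Simulates (ModGates q) FanoutGates :=
  (mod_simulates_phase (by omega)).trans (phase_simulates_fanout hq)

theorem reducible_fanoutFamily {t : ℕ} (ht : 0 < t) {F : OpFamily} (hF : F ∈ QACCmod t) :
    QAC0Reducible F fanoutFamily :=
  ((fanout_simulates_mod ht).mono (fun _ _ h => by cases h; exact .mk (G := fanoutFamily) _)
    fun _ _ => id).reducible hF

theorem reducible_modFamily {q : ℕ} (hq : 2 ≤ q) {F : OpFamily} (hF : F ∈ QAC0wf) :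
    QAC0Reducible F (modFamily q) :=
  ((mod_simulates_fanout hq).mono (fun _ _ h => by cases h; exact .mk (G := modFamily q) _)
    fun _ _ => id).reducible hF

theorem reducible_modFamily_of_mod {q t : ℕ} (hq : 2 ≤ q) (ht : 0 < t) {F : OpFamily}
    (hF : F ∈ QACCmod t) : QAC0Reducible F (modFamily q) :=
  (((mod_simulates_fanout hq).trans (fanout_simulates_mod ht)).mono
    (fun _ _ h => by cases h; exact .mk (G := modFamily q) _) fun _ _ => id).reducible hF

theorem constDepth_of_gate {ℰ : GateSet} {w : ℕ → ℕ} {R : ∀ n, Op (w n)}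
    (h : ∀ n, ℰ (w n) (R n)) : ConstDepth ℰ w R := by
  refine ⟨∅, 13, Set.finite_empty, Set.empty_subset _, fun n => ?_⟩
  exact (Circ.of_par (Par.gate (.extra (h n)))).isCircuit

theorem modFamily_mem (q : ℕ) : modFamily q ∈ QACCmod q :=
  constDepth_of_gate fun n => .mk n

theorem fanoutFamily_mem : fanoutFamily ∈ QAC0wf :=
  constDepth_of_gate fun n => .mk n

/-- Each class contains `modFamily q` or `fanoutFamily`, and every family in any of the classes
reduces to both, so these two serve as targets throughout. -/
theorem mainTheorem1 (q : ℕ) (hq : 2 ≤ q) :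
    ClassEq QACC (QACCmod q) ∧
    ClassEq QAC0wf (QACCmod q) ∧
    ClassEq QAC0wf QACC ∧
    QAC0Equiv (modFamily q) fanoutFamily ∧
    (∀ t : ℕ, 2 ≤ t → QAC0Equiv (modFamily q) (modFamily t)) := by
  have hq0 : 0 < q := by omega
  refine ⟨⟨?_, ?_⟩, ⟨?_, ?_⟩, ⟨?_, ?_⟩, ⟨?_, ?_⟩, fun t ht => ⟨?_, ?_⟩⟩
  · rintro F ⟨t, ht, hF⟩
    exact ⟨modFamily q, modFamily_mem q, reducible_modFamily_of_mod hq ht hF⟩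
  · intro G hG
    exact ⟨modFamily q, ⟨q, hq0, modFamily_mem q⟩, reducible_modFamily_of_mod hq hq0 hG⟩
  · intro F hF
    exact ⟨modFamily q, modFamily_mem q, reducible_modFamily hq hF⟩
  · intro G hG
    exact ⟨fanoutFamily, fanoutFamily_mem, reducible_fanoutFamily hq0 hG⟩
  · intro F hF
    exact ⟨modFamily q, ⟨q, hq0, modFamily_mem q⟩, reducible_modFamily hq hF⟩
  · rintro G ⟨t, ht, hG⟩
    exact ⟨fanoutFamily, fanoutFamily_mem, reducible_fanoutFamily ht hG⟩
  · exact reducible_fanoutFamily hq0 (modFamily_mem q)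
  · exact reducible_modFamily hq fanoutFamily_mem
  · exact reducible_modFamily_of_mod ht hq0 (modFamily_mem q)
  · exact reducible_modFamily_of_mod hq (by omega) (modFamily_mem t)
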